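/- Fix $k>0$ and let $\rho(r)=r^2/2$ for $|r|\le k$ and $\rho(r)=k|r|-k^2/2$ for $|r|>k$ be the Huber loss, with $\psi(r)=\rho'(r)=\max\{\min\{r,k\},-k\}$. Let $(\mathbf x,\epsilon),(\mathbf x_1,\epsilon_1),(\mathbf x_2,\epsilon_2),\dots$ be identically distributed random elements of $\mathbb R^p\times\mathbb R$, with $(\mathbf x_i,\epsilon_i)_{i\ge1}$ independent, and let $y_i=\mu^*+\mathbf x_i^{T}\beta^*+\epsilon_i$ for some $\mu^*\in\mathbb R$, $\beta^*\in\mathbb R^p$. Put $\mathbf w=(1,\mathbf x^{T})^{T}$. Assume that - $\mathbb E[\psi(\epsilon)\mid\mathbf x]=0$ ($\epsilon$ may depend on $\mathbf x$); - $\mathbb E\|\mathbf x\|^4<\infty$, and the covariance matrix $\Sigma_x^*$ of $\mathbf x$ is positive definite; write $\mu_x^*=\mathbb E[\mathbf x]$; - $\mathbb P(|\epsilon|=k)=0$ (so that $\psi'(\epsilon)$ exists almost surely), and the matrix $\mathbb E[\psi'(\epsilon)\mathbf w\mathbf w^{T}]$ is nonsingular. For each $n$ let $(\hat\mu_h,\hat\beta_h)$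 be a (measurable) minimizer of $\sum_{i=1}^n\rho(y_i-\mu-\mathbf x_i^{T}\beta)$ over $\mu\in\mathbb R$, $\beta\in\mathbb R^p$, and let $\bar{\mathbf x}=\frac1n\sum_{i=1}^n\mathbf x_i$ and $S_x=\frac1n\sum_{i=1}^n(\mathbf x_i-\bar{\mathbf x})(\mathbf x_i-\bar{\mathbf x})^{T}$. Let $\mathrm{vech}(M)\in\mathbb R^{p(p+1)/2}$ denote the vector of the lower triangular entries (diagonal included) of a symmetric $p\times p$ matrix $M$. Then, as $n\to\infty$, $$\sqrt n\begin{pmatrix}\hat\mu_h-\mu^*\\ \hat\beta_h-\beta^*\\ \mathrm{vech}(S_x)-\mathrm{vech}(\Sigma_x^*)\\ \bar{\mathbf x}-\mu_x^*\end{pmatrix}\xrightarrow{d}N\left(\mathbf 0,\ \mathbf U_1^{-1}\mathbf V_1\mathbf U_1^{-1}\right),$$ where $\mathbf U_1^{-1}\mathbf V_1\mathbf U_1^{-1}$ is positive semidefinite, $\mathbf U_1$ is the block diagonal matrix with diagonal blocks $$\mathbf U_{1,11}=\mathbb E[\psi'(\epsilon)\mathbf w\mathbf w^{T}],\quad \mathbf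 U_{1,22}=\mathbf I_{p(p+1)/2},\quad \mathbf U_{1,33}=\mathbf I_p,$$ and $\mathbf V_1=(\mathbf V_{1,ij})_{i,j=1,2,3}$ is the symmetric block matrix with $$\mathbf V_{1,11}=\mathbb E[\psi^2(\epsilon)\mathbf w\mathbf w^{T}],\quad \mathbf V_{1,22}=\mathrm{var}\big(\mathrm{vech}((\mathbf x-\mu_x^*)(\mathbf x-\mu_x^*)^{T})\big),\quad \mathbf V_{1,33}=\mathrm{var}(\mathbf x)=\Sigma_x^*,$$ $$\mathbf V_{1,23}=\mathbb E\big[\mathrm{vech}((\mathbf x-\mu_x^*)(\mathbf x-\mu_x^*)^{T})(\mathbf x-\mu_x^*)^{T}\big],\quad \mathbf V_{1,12}=0,\quad \mathbf V_{1,13}=0.$$ -/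

import Mathlib

open MeasureTheory ProbabilityTheory Filter Topology

noncomputable section

namespace HuberReg

/-- The Huber loss with tuning parameter `k`. -/
def rho (k r : ℝ) : ℝ := if |r| ≤ k then r ^ 2 / 2 else k * |r| - k ^ 2 / 2

/-- The Huber influence function: `r` truncated to `[-k, k]`. -/
def psi (k r : ℝ) : ℝ := max (min r k) (-k)

/-- Positions in the lower triangle (with diagonal) of a `p × p` matrix. -/
abbrev VechIdx (p : ℕ) : Type := {ij : Fin p × Fin p // ij.2 ≤ ij.1}

/-- Index set of the intercept and the slopes. -/
abbrev RegIdx (p : ℕ) : Type := Unit ⊕ Fin p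

/-- Index set of the joint parameter (intercept and slopes; `vech` of the covariance; mean). -/
abbrev ParamIdx (p : ℕ) : Type := RegIdx p ⊕ (VechIdx p ⊕ Fin p)

/-- Half-vectorization: the entries of the lower triangle. -/
def vech {p : ℕ} (M : Matrix (Fin p) (Fin p) ℝ) : VechIdx p → ℝ :=
  fun ij => M ij.1.1 ij.1.2

/-- The outer product `v vᵀ`. -/
def outer {ι : Type*} (v : ι → ℝ) : Matrix ι ι ℝ := Matrix.vecMulVec v v

/-- The regressor `w = (1, xᵀ)ᵀ`. -/
def design {p : ℕ} (x : EuclideanSpace ℝ (Fin p)) : RegIdx p → ℝ :=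
  Sum.elim (fun _ => 1) (fun j => x j)

/-- The joint vector `(m, bᵀ, vech(S)ᵀ, cᵀ)ᵀ`. -/
def joint {p : ℕ} (m : ℝ) (b : EuclideanSpace ℝ (Fin p)) (S : Matrix (Fin p) (Fin p) ℝ)
    (c : EuclideanSpace ℝ (Fin p)) : EuclideanSpace ℝ (ParamIdx p) :=
  WithLp.toLp 2 (Sum.elim (Sum.elim (fun _ => m) (fun j => b j))
    (Sum.elim (vech S) (fun j => c j)))

/-- The sum of Huber losses of the first `n` residuals, at intercept `m` and slope `b`. -/
def objective {p : ℕ} (k : ℝ) (n : ℕ) (y : ℕ → ℝ) (x : ℕ → EuclideanSpace ℝ (Fin p))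
    (m : ℝ) (b : EuclideanSpace ℝ (Fin p)) : ℝ :=
  ∑ i ∈ Finset.range n, rho k (y i - m - inner ℝ (x i) b)

/-- `(m, b)` is a Huber fit to the first `n` observations: a global minimizer of the
sum of Huber losses. -/
def IsHuberFit {p : ℕ} (k : ℝ) (n : ℕ) (y : ℕ → ℝ) (x : ℕ → EuclideanSpace ℝ (Fin p))
    (m : ℝ) (b : EuclideanSpace ℝ (Fin p)) : Prop :=
  ∀ (m' : ℝ) (b' : EuclideanSpace ℝ (Fin p)),
    objective k n y x m b ≤ objective k n y x m' b'

/-- The sample mean of the first `n` observations. -/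
def sampleMean {p : ℕ} (n : ℕ) (x : ℕ → EuclideanSpace ℝ (Fin p)) :
    EuclideanSpace ℝ (Fin p) :=
  (n : ℝ)⁻¹ • ∑ i ∈ Finset.range n, x i

/-- The sample covariance matrix of the first `n` observations (with divisor `n`). -/
def sampleCov {p : ℕ} (n : ℕ) (x : ℕ → EuclideanSpace ℝ (Fin p)) :
    Matrix (Fin p) (Fin p) ℝ :=
  (n : ℝ)⁻¹ • ∑ i ∈ Finset.range n, outer (fun j => (x i - sampleMean n x) j)

section Population

variable {Ω : Type*} [MeasurableSpace Ω]

/-- The covariance matrix of a random vector. -/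
def covMat {ι : Type*} (Y : Ω → ι → ℝ) (P : Measure Ω) : Matrix ι ι ℝ :=
  Matrix.of fun i j => cov[fun ω => Y ω i, fun ω => Y ω j; P]

/-- The population mean `μ_x` of `X`. -/
def muX {p : ℕ} (X : Ω → EuclideanSpace ℝ (Fin p)) (P : Measure Ω) :
    EuclideanSpace ℝ (Fin p) := ∫ ω, X ω ∂P

/-- The population covariance matrix `Σ_x` of `X`. -/
def SigmaX {p : ℕ} (X : Ω → EuclideanSpace ℝ (Fin p)) (P : Measure Ω) :
    Matrix (Fin p) (Fin p) ℝ := covMat (fun ω j => X ω j) P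

/-- `vech((X - μ_x)(X - μ_x)ᵀ)`. -/
def vechSq {p : ℕ} (X : Ω → EuclideanSpace ℝ (Fin p)) (P : Measure Ω) (ω : Ω) :
    VechIdx p → ℝ :=
  vech (outer fun j => (X ω - muX X P) j)

/-- The block `E[ψ'(ε) w wᵀ]`. -/
def U11 {p : ℕ} (k : ℝ) (X : Ω → EuclideanSpace ℝ (Fin p)) (e : Ω → ℝ) (P : Measure Ω) :
    Matrix (RegIdx p) (RegIdx p) ℝ :=
  Matrix.of fun a b => ∫ ω, deriv (psi k) (e ω) * outer (design (X ω)) a b ∂P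

/-- The block diagonal matrix with blocks `E[ψ'(ε) w wᵀ]`, `I` and `I`. -/
def U1 {p : ℕ} (k : ℝ) (X : Ω → EuclideanSpace ℝ (Fin p)) (e : Ω → ℝ) (P : Measure Ω) :
    Matrix (ParamIdx p) (ParamIdx p) ℝ :=
  Matrix.fromBlocks (U11 k X e P) 0 0 (Matrix.fromBlocks 1 0 0 1)

/-- The block `E[ψ(ε)² w wᵀ]`. -/
def V11 {p : ℕ} (k : ℝ) (X : Ω → EuclideanSpace ℝ (Fin p)) (e : Ω → ℝ) (P : Measure Ω) :
    Matrix (RegIdx p) (RegIdx p) ℝ :=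
  Matrix.of fun a b => ∫ ω, psi k (e ω) ^ 2 * outer (design (X ω)) a b ∂P

/-- The block `var(vech((X - μ_x)(X - μ_x)ᵀ))`. -/
def V22 {p : ℕ} (X : Ω → EuclideanSpace ℝ (Fin p)) (P : Measure Ω) :
    Matrix (VechIdx p) (VechIdx p) ℝ :=
  covMat (vechSq X P) P

/-- The block `E[vech((X - μ_x)(X - μ_x)ᵀ) (X - μ_x)ᵀ]`. -/
def V23 {p : ℕ} (X : Ω → EuclideanSpace ℝ (Fin p)) (P : Measure Ω) :
    Matrix (VechIdx p) (Fin p) ℝ :=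
  Matrix.of fun a j => ∫ ω, vechSq X P ω a * (X ω - muX X P) j ∂P

/-- The symmetric block matrix with vanishing `(1,2)` and `(1,3)` blocks. -/
def V1 {p : ℕ} (k : ℝ) (X : Ω → EuclideanSpace ℝ (Fin p)) (e : Ω → ℝ) (P : Measure Ω) :
    Matrix (ParamIdx p) (ParamIdx p) ℝ :=
  Matrix.fromBlocks (V11 k X e P) 0 0
    (Matrix.fromBlocks (V22 X P) (V23 X P) (V23 X P).transpose (SigmaX X P))

end Population

end HuberReg

end

/-! The proof rests on convexity and needs no preliminary consistency argument. In the true errors,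
the rescaled error `t = √n (θ̂ - θ*)` minimizes the convex function `∑ [ρ(εᵢ - wᵢᵀt/√n) - ρ(εᵢ)]`.
The Huber loss is piecewise quadratic or affine, so its second-order expansion is exact unless the
step `wᵢᵀt/√n` can reach a kink `±k`. Since `|ε| ≠ k` almost surely and `w` is square integrable,
the kink terms vanish in mean. Uniformly on balls the objective is then `tᵀ U11 t / 2 - Zₙᵀt +
o_P(1)`, with `Zₙ` the normalized sum of the `ψ(εᵢ) wᵢ` (`abs_objective_sub_quadratic_le`). A convex
function close to a strongly convex quadratic has its minimizer close to that of the quadratic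
(`norm_sub_lt_of_convex_of_close`), hence `t = U11⁻¹ Zₙ + o_P(1)`
(`tendstoInMeasure_huber_linearization`).

The sample mean is exactly a normalized sum, and centering the sample covariance costs only a
product of two normalized sums over `√n` (`sqrt_mul_sampleCov_sub`). The whole vector is therefore a
normalized sum of `U1⁻¹ score` plus a negligible term, and the multivariate central limit theorem
with Slutsky's lemma gives the limit. The scores have second moment matrix `V1`; its cross blocks
vanish because `ψ(ε)` is conditionally centered given `x` (`integral_score_mul_score`). -/

namespace HuberReg

/-! ### The Huber loss: subgradient, majorization, exact local expansion. -/

section Loss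

variable {k : ℝ}

lemma rho_of_abs_le {r : ℝ} (h : |r| ≤ k) : rho k r = r ^ 2 / 2 := if_pos h

lemma rho_of_lt (hk : 0 < k) {r : ℝ} (h : k < r) : rho k r = k * r - k ^ 2 / 2 := by
  have hr : |r| = r := abs_of_pos (hk.trans h)
  rw [rho, hr, if_neg (not_le.2 h)]

lemma rho_of_lt_neg (hk : 0 < k) {r : ℝ} (h : r < -k) : rho k r = -k * r - k ^ 2 / 2 := by
  have hr : |r| = -r := abs_of_neg (by linarith)
  rw [rho, hr, if_neg (by linarith)]
  ring

lemma psi_of_abs_le {r : ℝ} (h : |r| ≤ k) : psi k r = r := by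
  obtain ⟨h1, h2⟩ := abs_le.1 h
  rw [psi, min_eq_left h2, max_eq_left h1]

lemma psi_of_lt (hk : 0 < k) {r : ℝ} (h : k < r) : psi k r = k := by
  rw [psi, min_eq_right h.le, max_eq_left (by linarith)]

lemma psi_of_lt_neg (hk : 0 < k) {r : ℝ} (h : r < -k) : psi k r = -k := by
  rw [psi, min_eq_left (by linarith), max_eq_right h.le]

lemma abs_psi_le (hk : 0 < k) (r : ℝ) : |psi k r| ≤ k := by
  rw [abs_le, psi]
  exact ⟨le_max_right _ _, max_le (min_le_right _ _) (by linarith)⟩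

lemma continuous_psi : Continuous (psi k) := by
  unfold psi
  fun_prop

/-- A real number lies below, above or inside the band `[-k, k]`. -/
lemma band_cases (k r : ℝ) : r < -k ∨ k < r ∨ |r| ≤ k := by
  rcases lt_or_ge r (-k) with h | h
  · exact .inl h
  rcases lt_or_ge k r with hl | hr
  · exact .inr (.inl hl)
  · exact .inr (.inr (abs_le.2 ⟨h, hr⟩))

/-- The influence function is a subgradient of the Huber loss. -/
lemma rho_add_psi_mul_le (hk : 0 < k) (a b : ℝ) : rho k a + psi k a * (b - a) ≤ rho k b := by
  rcases band_cases k a with ha | ha | ha <;> rcases band_cases k b with hb | hb | hb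
  all_goals first
    | rw [rho_of_lt hk ha, psi_of_lt hk ha]
    | rw [rho_of_lt_neg hk ha, psi_of_lt_neg hk ha]
    | rw [rho_of_abs_le ha, psi_of_abs_le ha]
  all_goals first
    | rw [rho_of_lt hk hb]
    | rw [rho_of_lt_neg hk hb]
    | rw [rho_of_abs_le hb]
  all_goals try rw [abs_le] at ha
  all_goals try rw [abs_le] at hb
  all_goals nlinarith [sq_nonneg (a - b), sq_nonneg (b - k), sq_nonneg (b + k),
    sq_nonneg (a - k), sq_nonneg (a + k)]

/-- Quadratic majorization of the Huber loss. -/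
lemma rho_le_add_psi_mul_add_sq (hk : 0 < k) (a b : ℝ) :
    rho k b ≤ rho k a + psi k a * (b - a) + (b - a) ^ 2 / 2 := by
  rcases band_cases k a with ha | ha | ha <;> rcases band_cases k b with hb | hb | hb
  all_goals first
    | rw [rho_of_lt hk ha, psi_of_lt hk ha]
    | rw [rho_of_lt_neg hk ha, psi_of_lt_neg hk ha]
    | rw [rho_of_abs_le ha, psi_of_abs_le ha]
  all_goals first
    | rw [rho_of_lt hk hb]
    | rw [rho_of_lt_neg hk hb]
    | rw [rho_of_abs_le hb]
  all_goals try rw [abs_le] at ha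
  all_goals try rw [abs_le] at hb
  all_goals nlinarith [sq_nonneg (a - b), sq_nonneg (b - k), sq_nonneg (b + k),
    sq_nonneg (a - k), sq_nonneg (a + k)]

/-- Take the supporting line at the convex combination: weighting its two inequalities by `a` and
`b` cancels the linear terms. -/
lemma convexOn_rho (hk : 0 < k) : ConvexOn ℝ Set.univ (rho k) := by
  refine ⟨convex_univ, fun x _ y _ a b ha hb hab => ?_⟩
  simp only [smul_eq_mul]
  have h1 := rho_add_psi_mul_le hk (a * x + b * y) x
  have h2 := rho_add_psi_mul_le hk (a * x + b * y) y
  have h3 := mul_le_mul_of_nonneg_left h1 ha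
  have h4 := mul_le_mul_of_nonneg_left h2 hb
  obtain rfl : b = 1 - a := by linarith
  nlinarith

/-- Second-order expansion of the Huber loss: it is exact unless the step may cross a kink. -/
lemma abs_rho_sub_expansion_le (hk : 0 < k) (a h : ℝ) :
    |rho k (a - h) - rho k a + psi k a * h - (if |a| < k then 1 else 0) * (h ^ 2 / 2)|
      ≤ if |(|a| - k)| ≤ |h| then h ^ 2 else 0 := by
  by_cases hh : |(|a| - k)| ≤ |h|
  · rw [if_pos hh]
    -- The two bounds place `ρ(a - h) - ρ(a) + ψ(a) h` in `[0, h²/2]`, so either value of the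
    -- indicator leaves an error of at most `h²`.
    have h1 := rho_add_psi_mul_le hk a (a - h)
    have h2 := rho_le_add_psi_mul_add_sq hk a (a - h)
    have h3 := sq_nonneg h
    split_ifs <;> rw [abs_le] <;> constructor <;> nlinarith
  · rw [if_neg hh]
    push Not at hh
    -- The nearest kink is farther than `|h|`, so `a` and `a - h` lie on the same quadratic or
    -- affine piece and the expansion is exact.
    refine le_of_eq (abs_eq_zero.2 ?_)
    have hl : -|h| ≤ h := neg_abs_le h
    have hu : h ≤ |h| := le_abs_self h
    rcases lt_or_ge |a| k with ha | ha
    · rw [abs_of_neg (show |a| - k < 0 by linarith)] at hh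
      have hal := abs_lt.1 ha
      have hb : |a - h| ≤ k := (abs_sub a h).trans (by linarith)
      rw [if_pos ha, rho_of_abs_le hb, rho_of_abs_le ha.le, psi_of_abs_le ha.le]
      ring
    · rw [if_neg (not_lt.2 ha)]
      rw [abs_of_nonneg (show 0 ≤ |a| - k by linarith)] at hh
      rcases abs_cases a with ⟨h1, _⟩ | ⟨h1, _⟩
      · rw [rho_of_lt hk (r := a - h) (by linarith), rho_of_lt hk (r := a) (by
          linarith [abs_nonneg h]), psi_of_lt hk (by linarith [abs_nonneg h])]
        ring
      · rw [rho_of_lt_neg hk (r := a - h) (by linarith), rho_of_lt_neg hk (r := a) (by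
          linarith [abs_nonneg h]), psi_of_lt_neg hk (by linarith [abs_nonneg h])]
        ring

/-- Off the kinks `ψ` is locally the identity or a constant. This turns the `ψ'(ε)` of `U11` into
the indicator used in the expansion. -/
lemma deriv_psi_of_abs_ne (hk : 0 < k) {a : ℝ} (ha : |a| ≠ k) :
    deriv (psi k) a = if |a| < k then 1 else 0 := by
  rcases lt_or_gt_of_ne ha with h | h
  · rw [if_pos h]
    have : psi k =ᶠ[𝓝 a] id := by
      filter_upwards [continuous_abs.continuousAt.eventually_lt continuousAt_const h] with b hb
      exact psi_of_abs_le hb.le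
    rw [this.deriv_eq, deriv_id]
  · rw [if_neg (not_lt.2 h.le)]
    rcases lt_abs.1 h with hl | hr
    · have : psi k =ᶠ[𝓝 a] fun _ => k := by
        filter_upwards [lt_mem_nhds hl] with b hb using psi_of_lt hk hb
      rw [this.deriv_eq, deriv_const]
    · have : psi k =ᶠ[𝓝 a] fun _ => -k := by
        filter_upwards [gt_mem_nhds (show a < -k by linarith)] with b hb using psi_of_lt_neg hk hb
      rw [this.deriv_eq, deriv_const]

end Loss

/-! ### Calculus of convergence to zero in probability. -/

section InMeasure

variable {Ω : Type*} [MeasurableSpace Ω] {P : Measure Ω} {E F : Type*}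
  [NormedAddCommGroup E] [NormedAddCommGroup F]

lemma tendstoInMeasure_zero_iff {f : ℕ → Ω → E} :
    TendstoInMeasure P f atTop (fun _ => 0) ↔
      ∀ δ, 0 < δ → Tendsto (fun n => P {ω | δ ≤ ‖f n ω‖}) atTop (𝓝 0) := by
  simp [tendstoInMeasure_iff_norm]

/-- Domination in norm transfers convergence in measure to zero. -/
lemma tendstoInMeasure_zero_of_norm_le {f : ℕ → Ω → E} {g : ℕ → Ω → F}
    (hg : TendstoInMeasure P g atTop fun _ => 0)
    (hfg : ∀ᶠ n in atTop, ∀ᵐ ω ∂P, ‖f n ω‖ ≤ ‖g n ω‖) :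
    TendstoInMeasure P f atTop fun _ => 0 := by
  rw [tendstoInMeasure_zero_iff] at hg ⊢
  intro δ hδ
  refine tendsto_of_tendsto_of_tendsto_of_le_of_le' tendsto_const_nhds (hg δ hδ)
    (.of_forall fun _ => zero_le) ?_
  filter_upwards [hfg] with n hn
  refine measure_mono_ae ?_
  filter_upwards [hn] with ω hω h using le_trans h hω

lemma tendstoInMeasure_add_zero {f g : ℕ → Ω → E}
    (hf : TendstoInMeasure P f atTop fun _ => 0) (hg : TendstoInMeasure P g atTop fun _ => 0) :
    TendstoInMeasure P (fun n ω => f n ω + g n ω) atTop fun _ => 0 := by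
  rw [tendstoInMeasure_zero_iff] at hf hg ⊢
  intro δ hδ
  have h := (hf (δ / 2) (half_pos hδ)).add (hg (δ / 2) (half_pos hδ))
  rw [add_zero] at h
  refine tendsto_of_tendsto_of_tendsto_of_le_of_le tendsto_const_nhds h (fun _ => zero_le)
    fun n => (measure_mono fun ω hω => ?_).trans (measure_union_le _ _)
  simp only [Set.mem_union, Set.mem_ofPred_eq] at hω ⊢
  by_contra! hc
  linarith [norm_add_le (f n ω) (g n ω)]

lemma tendstoInMeasure_sum_zero {ι : Type*} (s : Finset ι) {f : ι → ℕ → Ω → E}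
    (hf : ∀ i ∈ s, TendstoInMeasure P (f i) atTop fun _ => 0) :
    TendstoInMeasure P (fun n ω => ∑ i ∈ s, f i n ω) atTop fun _ => 0 := by
  classical
  induction s using Finset.induction_on with
  | empty =>
    rw [tendstoInMeasure_zero_iff]
    intro δ hδ
    simp [not_le.2 hδ]
  | insert a s ha ih =>
    simp only [Finset.sum_insert ha]
    exact tendstoInMeasure_add_zero (hf a (by simp)) (ih fun i hi => hf i (by simp [hi]))

lemma tendstoInMeasure_const_mul_zero {f : ℕ → Ω → ℝ} (c : ℝ)
    (hf : TendstoInMeasure P f atTop fun _ => 0) :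
    TendstoInMeasure P (fun n ω => c * f n ω) atTop fun _ => 0 := by
  rw [tendstoInMeasure_zero_iff] at hf ⊢
  intro δ hδ
  -- The `+ 1` in the threshold covers `c = 0`.
  refine tendsto_of_tendsto_of_tendsto_of_le_of_le tendsto_const_nhds
    (hf (δ / (|c| + 1)) (by positivity)) (fun _ => zero_le) fun n => measure_mono fun ω hω => ?_
  simp only [Set.mem_ofPred_eq, norm_mul, Real.norm_eq_abs] at hω ⊢
  rw [div_le_iff₀ (by positivity)]
  nlinarith [abs_nonneg (f n ω)]

/-- A sequence of random vectors tends to zero in measure once all coordinates do. -/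
lemma tendstoInMeasure_zero_of_coord {ι : Type*} [Fintype ι] {f : ℕ → Ω → EuclideanSpace ℝ ι}
    (hf : ∀ i, TendstoInMeasure P (fun n ω => f n ω i) atTop fun _ => 0) :
    TendstoInMeasure P f atTop fun _ => 0 := by
  classical
  refine tendstoInMeasure_zero_of_norm_le
    (tendstoInMeasure_sum_zero Finset.univ (f := fun i n ω => |f n ω i|) fun i _ =>
      tendstoInMeasure_zero_of_norm_le (hf i) (.of_forall fun n => .of_forall fun ω => by simp))
    (.of_forall fun n => .of_forall fun ω => ?_)
  rw [Real.norm_of_nonneg (Finset.sum_nonneg fun _ _ => abs_nonneg _)]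
  conv_lhs => rw [← (EuclideanSpace.basisFun ι ℝ).sum_repr (f n ω)]
  refine (norm_sum_le _ _).trans (Finset.sum_le_sum fun i _ => ?_)
  simp [norm_smul]

/-- Convergence in mean to zero implies convergence in measure. -/
lemma tendstoInMeasure_zero_of_tendsto_integral {f : ℕ → Ω → ℝ} (hf : ∀ n, Integrable (f n) P)
    (h : Tendsto (fun n => ∫ ω, |f n ω| ∂P) atTop (𝓝 0)) :
    TendstoInMeasure P f atTop fun _ => 0 := by
  refine tendstoInMeasure_of_tendsto_eLpNorm one_ne_zero (fun n => (hf n).aestronglyMeasurable)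
    aestronglyMeasurable_const ?_
  have : ∀ n, eLpNorm (f n - fun _ => 0) 1 P = ENNReal.ofReal (∫ ω, |f n ω| ∂P) := fun n => by
    have h0 : (f n - fun _ => (0 : ℝ)) = f n := by ext; simp
    rw [h0, eLpNorm_one_eq_lintegral_enorm, ← ofReal_integral_norm_eq_lintegral_enorm (hf n)]
    rfl
  simp_rw [this]
  simpa using ENNReal.tendsto_ofReal h

end InMeasure

/-! ### Averages and normalized sums of i.i.d. terms. -/

section IID

variable {Ω : Type*} [MeasurableSpace Ω] {P : Measure Ω}
  {𝓧 : Type*} [MeasurableSpace 𝓧] {D : ℕ → Ω → 𝓧} {D₀ : Ω → 𝓧}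

lemma integrable_sample (hident : ∀ i, IdentDistrib (D i) D₀ P P) {f : 𝓧 → ℝ} (hf : Measurable f)
    (hint : Integrable (fun ω => f (D₀ ω)) P) (i : ℕ) : Integrable (fun ω => f (D i ω)) P :=
  ((hident i).comp hf).integrable_iff.2 hint

lemma integral_sample (hident : ∀ i, IdentDistrib (D i) D₀ P P) {f : 𝓧 → ℝ} (hf : Measurable f)
    (i : ℕ) : ∫ ω, f (D i ω) ∂P = ∫ ω, f (D₀ ω) ∂P :=
  ((hident i).comp hf).integral_eq

/-- The normalized sum `n^{-1/2} ∑ f(Dᵢ)`. -/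
noncomputable def rootSum (D : ℕ → Ω → 𝓧) (f : 𝓧 → ℝ) (n : ℕ) (ω : Ω) : ℝ :=
  (√(n : ℝ))⁻¹ * ∑ i ∈ Finset.range n, f (D i ω)

lemma memLp_rootSum (hident : ∀ i, IdentDistrib (D i) D₀ P P)
    {f : 𝓧 → ℝ} (hf : Measurable f) (h2 : MemLp (fun ω => f (D₀ ω)) 2 P) (n : ℕ) :
    MemLp (rootSum D f n) 2 P :=
  (memLp_finsetSum _ fun i _ => ((hident i).comp hf).memLp_iff.2 h2).const_mul _

/-- Averages of a triangular array whose terms vanish in mean tend to zero in probability. -/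
lemma tendstoInMeasure_average_array (hident : ∀ i, IdentDistrib (D i) D₀ P P) {f : ℕ → 𝓧 → ℝ}
    (hf : ∀ n, Measurable (f n)) (hint : ∀ n, Integrable (fun ω => f n (D₀ ω)) P)
    (hlim : Tendsto (fun n => ∫ ω, |f n (D₀ ω)| ∂P) atTop (𝓝 0)) :
    TendstoInMeasure P (fun (n : ℕ) ω => (n : ℝ)⁻¹ * ∑ i ∈ Finset.range n, f n (D i ω))
      atTop fun _ => 0 := by
  have hm : ∀ n i, Integrable (fun ω => f n (D i ω)) P := fun n =>
    integrable_sample hident (hf n) (hint n)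
  have hI : ∀ n : ℕ, Integrable (fun ω => (n : ℝ)⁻¹ * ∑ i ∈ Finset.range n, f n (D i ω)) P := fun n =>
    (integrable_finsetSum _ fun i _ => hm n i).const_mul _
  refine tendstoInMeasure_zero_of_tendsto_integral hI ?_
  refine tendsto_of_tendsto_of_tendsto_of_le_of_le tendsto_const_nhds hlim
    (fun n => integral_nonneg fun _ => abs_nonneg _) fun n => ?_
  calc ∫ ω, |(n : ℝ)⁻¹ * ∑ i ∈ Finset.range n, f n (D i ω)| ∂P
      ≤ ∫ ω, (n : ℝ)⁻¹ * ∑ i ∈ Finset.range n, |f n (D i ω)| ∂P := by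
        refine integral_mono (hI n).abs
          ((integrable_finsetSum _ fun i _ => (hm n i).abs).const_mul _) fun ω => ?_
        simp only
        rw [abs_mul, abs_of_nonneg (by positivity : (0 : ℝ) ≤ (n : ℝ)⁻¹)]
        gcongr
        exact Finset.abs_sum_le_sum_abs _ _
    _ = (n : ℝ)⁻¹ * (n * ∫ ω, |f n (D₀ ω)| ∂P) := by
        rw [integral_const_mul, integral_finsetSum _ fun i _ => (hm n i).abs]
        congr 1
        rw [Finset.sum_congr rfl fun i _ => integral_sample hident
          (f := fun d => |f n d|) (by fun_prop) i]
        simp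
    _ ≤ ∫ ω, |f n (D₀ ω)| ∂P := by
        have h0 : 0 ≤ ∫ ω, |f n (D₀ ω)| ∂P := integral_nonneg fun _ => abs_nonneg _
        rcases Nat.eq_zero_or_pos n with rfl | hn
        · simpa using h0
        · rw [inv_mul_cancel_left₀ (by positivity)]

variable [IsProbabilityMeasure P]

/-- The law of large numbers in probability for a function of the observations. -/
lemma tendstoInMeasure_average (hindep : iIndepFun D P) (hident : ∀ i, IdentDistrib (D i) D₀ P P)
    {f : 𝓧 → ℝ} (hf : Measurable f) (hint : Integrable (fun ω => f (D₀ ω)) P) :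
    TendstoInMeasure P
      (fun (n : ℕ) ω => (n : ℝ)⁻¹ * ∑ i ∈ Finset.range n, f (D i ω) - ∫ ω, f (D₀ ω) ∂P)
      atTop fun _ => 0 := by
  have hm : ∀ i, Integrable (fun ω => f (D i ω)) P := integrable_sample hident hf hint
  refine tendstoInMeasure_of_tendsto_ae (fun n => ?_) ?_
  · exact (((integrable_finsetSum _ fun i _ => hm i).const_mul _).sub
      (integrable_const _)).aestronglyMeasurable
  · have := strong_law_ae_real (fun i ω => f (D i ω)) (hm 0)
      (fun i j hij => (hindep.comp (fun _ => f) (fun _ => hf)).indepFun hij)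
      (fun i => ((hident i).comp hf).trans ((hident 0).comp hf).symm)
    filter_upwards [this] with ω hω
    rw [integral_sample hident hf 0] at hω
    have := hω.sub_const (∫ ω, f (D₀ ω) ∂P)
    rw [sub_self] at this
    refine this.congr fun n => ?_
    rw [div_eq_inv_mul]

/-- Second moment bound for the normalized sum of centered independent terms. -/
lemma integral_rootSum_sq_le (hindep : iIndepFun D P) (hident : ∀ i, IdentDistrib (D i) D₀ P P)
    {f : 𝓧 → ℝ} (hf : Measurable f) (h2 : MemLp (fun ω => f (D₀ ω)) 2 P)
    (h0 : ∫ ω, f (D₀ ω) ∂P = 0) (n : ℕ) :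
    ∫ ω, rootSum D f n ω ^ 2 ∂P ≤ ∫ ω, f (D₀ ω) ^ 2 ∂P := by
  have hm : ∀ i, MemLp (fun ω => f (D i ω)) 2 P := fun i => ((hident i).comp hf).memLp_iff.2 h2
  have hmean : ∫ ω, rootSum D f n ω ∂P = 0 := by
    unfold rootSum
    rw [integral_const_mul, integral_finsetSum _ fun i _ => (hm i).integrable one_le_two]
    simp [integral_sample hident hf, h0]
  have hvar : Var[rootSum D f n; P] = ((√(n : ℝ))⁻¹) ^ 2 * (n * ∫ ω, f (D₀ ω) ^ 2 ∂P) := by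
    have hs : Var[∑ i ∈ Finset.range n, fun ω => f (D i ω); P]
        = ∑ i ∈ Finset.range n, Var[fun ω => f (D i ω); P] :=
      IndepFun.variance_sum (fun i _ => hm i) fun i _ j _ hij =>
        (hindep.comp (fun _ => f) (fun _ => hf)).indepFun hij
    have he : rootSum D f n = fun ω => (√(n : ℝ))⁻¹ * (∑ i ∈ Finset.range n,
        fun ω => f (D i ω)) ω := by
      ext ω; simp [rootSum]
    rw [he, variance_const_mul, hs]
    congr 1
    have : ∀ i, Var[fun ω => f (D i ω); P] = ∫ ω, f (D₀ ω) ^ 2 ∂P := fun i => by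
      rw [variance_of_integral_eq_zero (hm i).aestronglyMeasurable.aemeasurable
        (by rw [integral_sample hident hf, h0])]
      exact integral_sample hident (f := fun d => f d ^ 2) (by fun_prop) i
    simp [this]
  rw [← variance_of_integral_eq_zero
    (memLp_rootSum hident hf h2 n).aestronglyMeasurable.aemeasurable hmean, hvar, inv_pow,
    Real.sq_sqrt (by positivity)]
  have hpos : 0 ≤ ∫ ω, f (D₀ ω) ^ 2 ∂P := integral_nonneg fun _ => sq_nonneg _
  -- Equality holds for `n > 0`; at `n = 0` the normalized sum is zero, which is why only `≤` is
  -- claimed.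
  rcases Nat.eq_zero_or_pos n with rfl | hn
  · simpa using hpos
  · rw [inv_mul_cancel_left₀ (by positivity)]

/-- The product of two normalized sums, divided by `√n`, is negligible. -/
lemma tendstoInMeasure_inv_sqrt_mul_rootSum_mul (hindep : iIndepFun D P)
    (hident : ∀ i, IdentDistrib (D i) D₀ P P)
    {f g : 𝓧 → ℝ} (hf : Measurable f) (hf2 : MemLp (fun ω => f (D₀ ω)) 2 P)
    (hf0 : ∫ ω, f (D₀ ω) ∂P = 0) (hg : Measurable g) (hg2 : MemLp (fun ω => g (D₀ ω)) 2 P)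
    (hg0 : ∫ ω, g (D₀ ω) ∂P = 0) :
    TendstoInMeasure P (fun (n : ℕ) ω => (√(n : ℝ))⁻¹ * (rootSum D f n ω * rootSum D g n ω))
      atTop fun _ => 0 := by
  have mf := memLp_rootSum hident hf hf2
  have mg := memLp_rootSum hident hg hg2
  have hI : ∀ n : ℕ, Integrable
      (fun ω => (√(n : ℝ))⁻¹ * (rootSum D f n ω * rootSum D g n ω)) P := fun n =>
    ((mf n).integrable_mul (mg n)).const_mul _
  refine tendstoInMeasure_zero_of_tendsto_integral hI ?_
  -- By `|ab| ≤ a² + b²`, `C` bounds the mean absolute product of the two normalized sums for every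
  -- `n`.
  set C := ∫ ω, f (D₀ ω) ^ 2 ∂P + ∫ ω, g (D₀ ω) ^ 2 ∂P
  have hlim : Tendsto (fun n : ℕ => (√(n : ℝ))⁻¹ * C) atTop (𝓝 0) := by
    rw [← zero_mul C]
    exact .mul_const C (tendsto_inv_atTop_zero.comp <| Real.tendsto_sqrt_atTop.comp <|
      tendsto_natCast_atTop_atTop)
  refine tendsto_of_tendsto_of_tendsto_of_le_of_le tendsto_const_nhds hlim
    (fun n => integral_nonneg fun _ => abs_nonneg _) fun n => ?_
  calc ∫ ω, |(√(n : ℝ))⁻¹ * (rootSum D f n ω * rootSum D g n ω)| ∂P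
      ≤ ∫ ω, (√(n : ℝ))⁻¹ * (rootSum D f n ω ^ 2 + rootSum D g n ω ^ 2) ∂P := by
        refine integral_mono (hI n).abs
          (((mf n).integrable_sq.add (mg n).integrable_sq).const_mul _) fun ω => ?_
        simp only
        rw [abs_mul, abs_of_nonneg (by positivity : (0 : ℝ) ≤ (√(n : ℝ))⁻¹), abs_mul]
        gcongr
        nlinarith [sq_nonneg (|rootSum D f n ω| - |rootSum D g n ω|), sq_abs (rootSum D f n ω),
          sq_abs (rootSum D g n ω), sq_nonneg (rootSum D f n ω), sq_nonneg (rootSum D g n ω)]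
    _ ≤ (√(n : ℝ))⁻¹ * C := by
        rw [integral_const_mul, integral_add (mf n).integrable_sq (mg n).integrable_sq]
        gcongr
        exact add_le_add (integral_rootSum_sq_le hindep hident hf hf2 hf0 n)
          (integral_rootSum_sq_le hindep hident hg hg2 hg0 n)

end IID

/-! ### Second moment matrices and the multivariate central limit theorem. -/

section CLT

variable {Ω : Type*} [MeasurableSpace Ω] {P : Measure Ω}
  {𝓧 : Type*} [MeasurableSpace 𝓧] {D : ℕ → Ω → 𝓧} {D₀ : Ω → 𝓧}
  {ι : Type*} [Fintype ι] {S : Matrix ι ι ℝ}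

/-- Second moments of linear combinations, from the matrix of second moments. -/
lemma integral_dotProduct_mul_dotProduct {Y : Ω → ι → ℝ} (h2 : ∀ a, MemLp (fun ω => Y ω a) 2 P)
    (hS : ∀ a b, ∫ ω, Y ω a * Y ω b ∂P = S a b) (s t : ι → ℝ) :
    ∫ ω, (s ⬝ᵥ Y ω) * (t ⬝ᵥ Y ω) ∂P = s ⬝ᵥ S.mulVec t := by
  have hI : ∀ a b, Integrable (fun ω => s a * t b * (Y ω a * Y ω b)) P := fun a b =>
    ((h2 a).integrable_mul (h2 b)).const_mul _
  have he : ∀ ω, (s ⬝ᵥ Y ω) * (t ⬝ᵥ Y ω) = ∑ a, ∑ b, s a * t b * (Y ω a * Y ω b) := fun ω => by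
    simp only [dotProduct, Finset.sum_mul_sum]
    exact Finset.sum_congr rfl fun a _ => Finset.sum_congr rfl fun b _ => by ring
  simp_rw [he]
  rw [integral_finsetSum _ fun a _ => integrable_finsetSum _ fun b _ => hI a b]
  simp only [dotProduct, Matrix.mulVec, Finset.mul_sum]
  refine Finset.sum_congr rfl fun a _ => ?_
  rw [integral_finsetSum _ fun b _ => hI a b]
  refine Finset.sum_congr rfl fun b _ => ?_
  rw [integral_const_mul, hS]
  ring

/-- The quadratic form at `t` is the mean of `(tᵀY)²`. It serves both for `U11` and for the limiting
covariance. -/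
lemma posSemidef_of_second_moments {Y : Ω → ι → ℝ} (h2 : ∀ a, MemLp (fun ω => Y ω a) 2 P)
    (hS : ∀ a b, ∫ ω, Y ω a * Y ω b ∂P = S a b) : S.PosSemidef := by
  refine Matrix.PosSemidef.of_dotProduct_mulVec_nonneg ?_ fun t => ?_
  · ext a b
    simp only [Matrix.conjTranspose_apply, star_trivial, ← hS]
    simp_rw [mul_comm]
  · rw [star_trivial, ← integral_dotProduct_mul_dotProduct h2 hS]
    exact integral_nonneg fun ω => mul_self_nonneg _

/-- The **multivariate central limit theorem** for a centered function of i.i.d. observations. -/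
theorem tendstoInDistribution_inv_sqrt_smul_sum [IsProbabilityMeasure P] [DecidableEq ι]
    (hindep : iIndepFun D P)
    (hident : ∀ i, IdentDistrib (D i) D₀ P P)
    {Y : 𝓧 → EuclideanSpace ℝ ι} (hY : Measurable Y)
    (h2 : ∀ a, MemLp (fun ω => Y (D₀ ω) a) 2 P) (h0 : ∀ a, ∫ ω, Y (D₀ ω) a ∂P = 0)
    (hS : ∀ a b, ∫ ω, Y (D₀ ω) a * Y (D₀ ω) b ∂P = S a b) :
    TendstoInDistribution (fun (n : ℕ) ω => (√(n : ℝ))⁻¹ • ∑ i ∈ Finset.range n, Y (D i ω))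
      atTop (id : EuclideanSpace ℝ ι → EuclideanSpace ℝ ι) (fun _ => P)
      (multivariateGaussian 0 S) := by
  have hpsd : S.PosSemidef := posSemidef_of_second_moments (Y := fun ω a => Y (D₀ ω) a) h2 hS
  have hYm : ∀ i, AEMeasurable (fun ω => Y (D i ω)) P := fun i =>
    hY.comp_aemeasurable (hident i).aemeasurable_fst
  have hmeas : ∀ n : ℕ, AEMeasurable
      (fun ω => (√(n : ℝ))⁻¹ • ∑ i ∈ Finset.range n, Y (D i ω)) P := fun n =>
    (Finset.aemeasurable_fun_sum _ fun i _ => hYm i).fun_const_smul _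
  refine ⟨hmeas, aemeasurable_id, ?_⟩
  refine ProbabilityMeasure.tendsto_iff_tendsto_charFun.2 fun t => ?_
  -- Cramér–Wold: the characteristic function at `t` of the vector sum is that at `1` of the scalar
  -- sum of the projections `f`.
  let f : 𝓧 → ℝ := fun d => inner ℝ (Y d) t
  have hf : Measurable f := by fun_prop
  have hfe : ∀ d, f d = (t : ι → ℝ) ⬝ᵥ (Y d : ι → ℝ) := fun d => by
    simp [f, dotProduct, PiLp.inner_apply]
  have hf2 : MemLp (fun ω => f (D₀ ω)) 2 P := by
    simp only [hfe, dotProduct]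
    exact memLp_finsetSum _ fun a _ => (h2 a).const_mul _
  have hf0 : ∫ ω, f (D₀ ω) ∂P = 0 := by
    simp only [hfe, dotProduct]
    rw [integral_finsetSum _ fun a _ => ((h2 a).integrable one_le_two).const_mul _]
    simp [integral_const_mul, h0]
  have hfv : ∫ ω, f (D₀ ω) ^ 2 ∂P = (t : ι → ℝ) ⬝ᵥ S.mulVec (t : ι → ℝ) := by
    simp only [hfe, sq]
    exact integral_dotProduct_mul_dotProduct (Y := fun ω a => Y (D₀ ω) a) h2 hS _ _
  have hm : ∀ i, AEMeasurable (fun ω => f (D i ω)) P := fun i =>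
    hf.comp_aemeasurable (hident i).aemeasurable_fst
  have hvar : Var[fun ω => f (D 0 ω); P] = (t : ι → ℝ) ⬝ᵥ S.mulVec (t : ι → ℝ) := by
    rw [variance_of_integral_eq_zero (hm 0) (by rw [integral_sample hident hf, hf0]), ← hfv]
    exact integral_sample hident (f := fun d => f d ^ 2) (by fun_prop) 0
  have hclt := tendstoInDistribution_inv_sqrt_mul_sum_sub (P := P)
    (P' := gaussianReal 0 Var[fun ω => f (D 0 ω); P].toNNReal) (Y := id)
    (X := fun i ω => f (D i ω)) HasLaw.id
    (((hident 0).comp hf).memLp_iff.2 hf2) (hindep.comp (fun _ => f) fun _ => hf)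
    (fun i => ((hident i).comp hf).trans ((hident 0).comp hf).symm)
  have h1 := ProbabilityMeasure.tendsto_iff_tendsto_charFun.1 hclt.tendsto 1
  simp only [ProbabilityMeasure.coe_mk, Measure.map_id] at h1 ⊢
  rw [charFun_gaussianReal, hvar, Real.coe_toNNReal _
    (by simpa using hpsd.dotProduct_mulVec_nonneg (t : ι → ℝ))] at h1
  rw [charFun_multivariateGaussian hpsd]
  convert h1 using 1
  · ext n
    rw [charFun_apply, charFun_apply, integral_map (hmeas n) (by fun_prop),
      integral_map (hclt.forall_aemeasurable n) (by fun_prop)]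
    refine integral_congr_ae (.of_forall fun ω => ?_)
    simp [inner_smul_left, sum_inner, f, integral_sample hident hf, hf0]
  · simp

end CLT

/-! ### Stability of minimizers of convex functions. -/

section Argmin

/-- A minimizer of a convex function that is uniformly close to a strongly convex one on a ball
lies near the minimizer of the latter. -/
lemma norm_sub_lt_of_convex_of_close {E : Type*} [NormedAddCommGroup E] [NormedSpace ℝ E]
    {A q : E → ℝ} {T t₀ : E} {R M c δ : ℝ} (hA : ConvexOn ℝ Set.univ A) (hT : ∀ t, A T ≤ A t)
    (hclose : ∀ t, ‖t‖ ≤ M → |A t - q t| ≤ R) (hq : ∀ t, q t₀ + c * ‖t - t₀‖ ^ 2 ≤ q t)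
    (hδ : 0 < δ) (hM : ‖t₀‖ + δ ≤ M) (hR : 2 * R < c * δ ^ 2) : ‖T - t₀‖ < δ := by
  by_contra! h
  have hpos : 0 < ‖T - t₀‖ := hδ.trans_le h
  -- `T` may leave the ball where `A` and `q` are close, so it is replaced by the point `s` of the
  -- segment from `t₀` to `T` at distance `δ` from `t₀`. Convexity gives `A s ≤ A t₀`, while `q`
  -- grows by `c δ²`, more than the total error `2 R`.
  set τ := δ / ‖T - t₀‖
  have hτ0 : 0 ≤ τ := by positivity
  have hτ1 : τ ≤ 1 := (div_le_one hpos).2 h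
  set s := (1 - τ) • t₀ + τ • T
  have hs : s - t₀ = τ • (T - t₀) := by simp only [s]; module
  have hsn : ‖s - t₀‖ = δ := by
    rw [hs, norm_smul, Real.norm_of_nonneg hτ0, div_mul_cancel₀ _ hpos.ne']
  have hAs : A s ≤ A t₀ := by
    have h1 := hA.2 (Set.mem_univ t₀) (Set.mem_univ T) (sub_nonneg.2 hτ1) hτ0 (by ring)
    simp only [smul_eq_mul] at h1
    nlinarith [hT t₀]
  have hsM : ‖s‖ ≤ M := by
    have := norm_add_le t₀ (s - t₀)
    rw [add_sub_cancel, hsn] at this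
    linarith
  have h1 := abs_le.1 (hclose s hsM)
  have h2 := abs_le.1 (hclose t₀ (by linarith))
  have h3 := hq s
  rw [hsn] at h3
  linarith [h1.1, h2.2]

variable {ι : Type*} [Fintype ι]

/-- A positive definite quadratic form dominates a multiple of the squared Euclidean norm. -/
lemma exists_pos_mul_norm_sq_le {U : Matrix ι ι ℝ} (hU : U.PosDef) :
    ∃ c > 0, ∀ t : EuclideanSpace ℝ ι, c * ‖t‖ ^ 2 ≤ (t : ι → ℝ) ⬝ᵥ U.mulVec (t : ι → ℝ) := by
  have hcont : Continuous fun t : EuclideanSpace ℝ ι => (t : ι → ℝ) ⬝ᵥ U.mulVec (t : ι → ℝ) := by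
    simp only [dotProduct, Matrix.mulVec]
    fun_prop
  -- The sphere is empty when `ι` is. Otherwise `c` is the minimum of the form on the compact
  -- sphere, extended by homogeneity.
  rcases (Metric.sphere (0 : EuclideanSpace ℝ ι) 1).eq_empty_or_nonempty with he | hne
  · refine ⟨1, one_pos, fun t => ?_⟩
    have ht : t = 0 := by
      by_contra h
      have : (‖t‖⁻¹ • t) ∈ Metric.sphere (0 : EuclideanSpace ℝ ι) 1 := by
        simp [norm_smul, h]
      rw [he] at this
      exact this
    simp [ht]
  · obtain ⟨t₀, ht₀, hmin⟩ := (isCompact_sphere (0 : EuclideanSpace ℝ ι) 1).exists_isMinOn hne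
      hcont.continuousOn
    have hne0 : (t₀ : ι → ℝ) ≠ 0 := by
      intro h
      have : t₀ = 0 := by ext i; exact congrFun h i
      simp [this] at ht₀
    refine ⟨_, by simpa using hU.dotProduct_mulVec_pos hne0, fun t => ?_⟩
    rcases eq_or_ne t 0 with rfl | h
    · simp
    have hn : 0 < ‖t‖ := norm_pos_iff.2 h
    have hmem : (‖t‖⁻¹ • t) ∈ Metric.sphere (0 : EuclideanSpace ℝ ι) 1 := by
      simp [norm_smul, h]
    have := hmin hmem
    simp only [Set.mem_ofPred_eq, WithLp.ofLp_smul, Matrix.mulVec_smul,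
      smul_dotProduct, dotProduct_smul, smul_eq_mul] at this
    calc _ ≤ (‖t‖⁻¹ * (‖t‖⁻¹ * ((t : ι → ℝ) ⬝ᵥ U.mulVec (t : ι → ℝ)))) * ‖t‖ ^ 2 := by gcongr
      _ = _ := by field_simp

/-- Completing the square. -/
lemma quadratic_sub_eq {U : Matrix ι ι ℝ} (hU : U.IsSymm) {z t₀ : ι → ℝ}
    (hz : U.mulVec t₀ = z) (t : ι → ℝ) :
    (t ⬝ᵥ U.mulVec t) / 2 - z ⬝ᵥ t =
      (t₀ ⬝ᵥ U.mulVec t₀) / 2 - z ⬝ᵥ t₀ + ((t - t₀) ⬝ᵥ U.mulVec (t - t₀)) / 2 := by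
  have hs : t₀ ⬝ᵥ U.mulVec t = U.mulVec t₀ ⬝ᵥ t := by
    rw [Matrix.dotProduct_mulVec, ← Matrix.mulVec_transpose, hU.eq]
  have hc : t ⬝ᵥ z = z ⬝ᵥ t := dotProduct_comm _ _
  have hcomm₀ : t₀ ⬝ᵥ z = z ⬝ᵥ t₀ := dotProduct_comm _ _
  rw [hz] at hs
  simp only [Matrix.mulVec_sub, dotProduct_sub, sub_dotProduct, hz, hs, hc, hcomm₀]
  ring

end Argmin

/-! ### Deterministic quadratic expansion of the objective. -/

section Expansion

variable {ι : Type*} [Fintype ι] {k : ℝ}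

/-- The part of `‖w‖²` carried by the residuals within distance `M ‖w‖ / √n` of a kink. -/
noncomputable def kinkMass (k M : ℝ) (n : ℕ) (w : EuclideanSpace ℝ ι) (r : ℝ) : ℝ :=
  if |(|r| - k)| ≤ M * ‖w‖ / √(n : ℝ) then ‖w‖ ^ 2 else 0

/-- Uniform quadratic expansion of the rescaled empirical Huber objective over a ball. -/
lemma abs_objective_sub_quadratic_le (hk : 0 < k) {n : ℕ} (hn : 0 < n)
    (w : ℕ → EuclideanSpace ℝ ι) (r : ℕ → ℝ) (U : Matrix ι ι ℝ) {M : ℝ} (hM : 0 ≤ M)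
    {t : EuclideanSpace ℝ ι} (ht : ‖t‖ ≤ M) :
    |(∑ i ∈ Finset.range n, (rho k (r i - inner ℝ (w i) ((√(n : ℝ))⁻¹ • t)) - rho k (r i))) -
      (((t : ι → ℝ) ⬝ᵥ U.mulVec (t : ι → ℝ)) / 2 -
        (fun a => (√(n : ℝ))⁻¹ * ∑ i ∈ Finset.range n, psi k (r i) * w i a) ⬝ᵥ (t : ι → ℝ))|
      ≤ M ^ 2 * ((n : ℝ)⁻¹ * ∑ i ∈ Finset.range n, kinkMass k M n (w i) (r i)) +
        M ^ 2 * ∑ a, ∑ b, |(n : ℝ)⁻¹ * ∑ i ∈ Finset.range n,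
          (if |r i| < k then 1 else 0) * (w i a * w i b) - U a b| := by
  have hsq : (0 : ℝ) < √(n : ℝ) := by positivity
  set h : ℕ → ℝ := fun i => inner ℝ (w i) ((√(n : ℝ))⁻¹ • t) with hh
  set I : ℕ → ℝ := fun i => if |r i| < k then 1 else 0 with hI
  have hin : ∀ i, h i = (√(n : ℝ))⁻¹ * ∑ a, w i a * t a := fun i => by
    simp only [hh, inner_smul_right, PiLp.inner_apply]
    congr 1
    exact Finset.sum_congr rfl fun a _ => by simp [mul_comm]
  have hlin : (fun a => (√(n : ℝ))⁻¹ * ∑ i ∈ Finset.range n, psi k (r i) * w i a) ⬝ᵥ (t : ι → ℝ)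
      = ∑ i ∈ Finset.range n, psi k (r i) * h i := by
    simp only [dotProduct, hin, Finset.mul_sum, Finset.sum_mul]
    rw [Finset.sum_comm]
    exact Finset.sum_congr rfl fun i _ => Finset.sum_congr rfl fun a _ => by ring
  -- Expanding entrywise isolates `t` in the factors `t a * t b`, so the resulting bound is uniform
  -- over the ball.
  have hquad : ∑ i ∈ Finset.range n, I i * h i ^ 2 - (t : ι → ℝ) ⬝ᵥ U.mulVec (t : ι → ℝ)
      = ∑ a, ∑ b, ((n : ℝ)⁻¹ * ∑ i ∈ Finset.range n, I i * (w i a * w i b) - U a b) *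
        (t a * t b) := by
    have h1 : ∀ i, I i * h i ^ 2 = ∑ a, ∑ b, (n : ℝ)⁻¹ * (I i * (w i a * w i b)) * (t a * t b) :=
      fun i => by
        have hs : ((√(n : ℝ))⁻¹) ^ 2 = (n : ℝ)⁻¹ := by rw [inv_pow, Real.sq_sqrt (by positivity)]
        rw [hin, mul_pow, hs, sq (∑ a, _), Finset.sum_mul_sum, Finset.mul_sum, Finset.mul_sum]
        refine Finset.sum_congr rfl fun a _ => ?_
        rw [Finset.mul_sum, Finset.mul_sum]
        exact Finset.sum_congr rfl fun b _ => by ring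
    simp only [h1, sub_mul, Finset.sum_sub_distrib]
    congr 1
    · rw [Finset.sum_comm]
      refine Finset.sum_congr rfl fun a _ => ?_
      rw [Finset.sum_comm]
      refine Finset.sum_congr rfl fun b _ => ?_
      rw [Finset.mul_sum, Finset.sum_mul]
    · simp only [dotProduct, Matrix.mulVec, Finset.mul_sum]
      exact Finset.sum_congr rfl fun a _ => Finset.sum_congr rfl fun b _ => by ring
  have hsplit : (∑ i ∈ Finset.range n, (rho k (r i - h i) - rho k (r i))) -
      (((t : ι → ℝ) ⬝ᵥ U.mulVec (t : ι → ℝ)) / 2 - ∑ i ∈ Finset.range n, psi k (r i) * h i)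
      = ∑ i ∈ Finset.range n,
          (rho k (r i - h i) - rho k (r i) + psi k (r i) * h i - I i * (h i ^ 2 / 2)) +
        (∑ i ∈ Finset.range n, I i * h i ^ 2 - (t : ι → ℝ) ⬝ᵥ U.mulVec (t : ι → ℝ)) / 2 := by
    have : ∑ i ∈ Finset.range n, I i * (h i ^ 2 / 2)
        = (∑ i ∈ Finset.range n, I i * h i ^ 2) / 2 := by
      rw [Finset.sum_div]
      exact Finset.sum_congr rfl fun i _ => by ring
    rw [Finset.sum_sub_distrib (f := fun i => rho k (r i - h i) - rho k (r i) + psi k (r i) * h i),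
      Finset.sum_add_distrib, this]
    ring
  have hta : ∀ a, |t a| ≤ M := fun a => (PiLp.norm_apply_le t a).trans ht
  rw [hlin, hsplit, hquad]
  refine (abs_add_le _ _).trans (add_le_add ?_ ?_)
  · rw [Finset.mul_sum, Finset.mul_sum]
    refine (Finset.abs_sum_le_sum_abs _ _).trans (Finset.sum_le_sum fun i _ => ?_)
    refine (abs_rho_sub_expansion_le hk (r i) (h i)).trans ?_
    -- Cauchy–Schwarz: every kink within reach of `h i` is counted by `kinkMass`, whatever `t` in
    -- the ball.
    have hle : |h i| ≤ M * ‖w i‖ / √(n : ℝ) := by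
      refine (abs_real_inner_le_norm _ _).trans ?_
      rw [norm_smul, Real.norm_of_nonneg (by positivity), div_eq_mul_inv]
      calc ‖w i‖ * ((√(n : ℝ))⁻¹ * ‖t‖) ≤ ‖w i‖ * ((√(n : ℝ))⁻¹ * M) := by gcongr
        _ = _ := by ring
    unfold kinkMass
    split_ifs with h1 h2 h2
    · calc h i ^ 2 = |h i| ^ 2 := (sq_abs _).symm
        _ ≤ (M * ‖w i‖ / √(n : ℝ)) ^ 2 := by gcongr
        _ = _ := by
          rw [div_pow, Real.sq_sqrt (by positivity)]
          ring
    · exact absurd (h1.trans hle) h2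
    · positivity
    · simp
  · rw [abs_div, abs_two]
    refine (half_le_self (abs_nonneg _)).trans ?_
    rw [Finset.mul_sum]
    refine (Finset.abs_sum_le_sum_abs _ _).trans (Finset.sum_le_sum fun a _ => ?_)
    rw [Finset.mul_sum]
    refine (Finset.abs_sum_le_sum_abs _ _).trans (Finset.sum_le_sum fun b _ => ?_)
    rw [abs_mul, abs_mul, mul_comm, sq]
    gcongr
    · exact hta a
    · exact hta b

end Expansion

/-! ### Asymptotic linearity of the Huber estimator. -/

section Linearization

variable {Ω : Type*} [MeasurableSpace Ω] {P : Measure Ω}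
  {𝓧 : Type*} [MeasurableSpace 𝓧] {D : ℕ → Ω → 𝓧} {D₀ : Ω → 𝓧}
  {ι : Type*} [Fintype ι] {k : ℝ}

/-- Dominated convergence with envelope `‖W‖²`: almost surely `|r| ≠ k`, so the window around the
kinks, of width `M ‖W‖ / √n`, eventually excludes `r`. -/
lemma tendstoInMeasure_average_kinkMass (hident : ∀ i, IdentDistrib (D i) D₀ P P)
    {W : 𝓧 → EuclideanSpace ℝ ι} {r : 𝓧 → ℝ} (hW : Measurable W) (hr : Measurable r)
    (hW2 : Integrable (fun ω => ‖W (D₀ ω)‖ ^ 2) P) (hatom : ∀ᵐ ω ∂P, |r (D₀ ω)| ≠ k) (M : ℝ) :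
    TendstoInMeasure P
      (fun (n : ℕ) ω => (n : ℝ)⁻¹ * ∑ i ∈ Finset.range n, kinkMass k M n (W (D i ω)) (r (D i ω)))
      atTop fun _ => 0 := by
  have hD₀ : AEMeasurable D₀ P := (hident 0).aemeasurable_snd
  have hmeas : ∀ n, Measurable fun d => kinkMass k M n (W d) (r d) := fun n => by
    unfold kinkMass
    refine Measurable.ite (measurableSet_le ?_ ?_) ?_ measurable_const <;> fun_prop
  have hbound : ∀ n d, |kinkMass k M n (W d) (r d)| ≤ ‖W d‖ ^ 2 := fun n d => by
    unfold kinkMass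
    split_ifs <;> simp
  have hdom : ∀ n, ∀ᵐ ω ∂P, ‖|kinkMass k M n (W (D₀ ω)) (r (D₀ ω))|‖ ≤ ‖W (D₀ ω)‖ ^ 2 :=
    fun n => .of_forall fun ω => by rw [Real.norm_eq_abs, abs_abs]; exact hbound n _
  have hsm : ∀ n, AEStronglyMeasurable
      (fun ω => kinkMass k M n (W (D₀ ω)) (r (D₀ ω))) P := fun n =>
    ((hmeas n).comp_aemeasurable hD₀).aestronglyMeasurable
  refine tendstoInMeasure_average_array (f := fun n d => kinkMass k M n (W d) (r d)) hident hmeas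
    (fun n => hW2.mono' (hsm n) (.of_forall fun ω => hbound n _)) ?_
  have := tendsto_integral_of_dominated_convergence (μ := P)
    (F := fun n ω => |kinkMass k M n (W (D₀ ω)) (r (D₀ ω))|) (f := fun _ => (0 : ℝ))
    (fun ω => ‖W (D₀ ω)‖ ^ 2) (fun n => (hsm n).norm) hW2 hdom ?_
  · rw [integral_zero] at this
    exact this
  filter_upwards [hatom] with ω hω
  have hpos : 0 < |(|r (D₀ ω)| - k)| := abs_pos.2 (sub_ne_zero.2 hω)
  have hlim : Tendsto (fun n : ℕ => M * ‖W (D₀ ω)‖ / √(n : ℝ)) atTop (𝓝 0) :=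
    tendsto_const_nhds.div_atTop (Real.tendsto_sqrt_atTop.comp tendsto_natCast_atTop_atTop)
  refine tendsto_const_nhds.congr' ?_
  filter_upwards [hlim.eventually_lt_const hpos] with n hn
  rw [kinkMass, if_neg (not_le.2 hn), abs_zero]

variable [IsProbabilityMeasure P]

/-- A normalized sum of centered square integrable vectors is bounded in probability. -/
lemma measure_norm_rootSum_ge_le (hindep : iIndepFun D P)
    (hident : ∀ i, IdentDistrib (D i) D₀ P P) {g : ι → 𝓧 → ℝ} (hg : ∀ a, Measurable (g a))
    (h2 : ∀ a, MemLp (fun ω => g a (D₀ ω)) 2 P) (h0 : ∀ a, ∫ ω, g a (D₀ ω) ∂P = 0)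
    (n : ℕ) {M : ℝ} (hM : 0 < M) :
    P.real {ω | M ≤ ‖WithLp.toLp 2 fun a => rootSum D (g a) n ω‖}
      ≤ (∑ a, ∫ ω, g a (D₀ ω) ^ 2 ∂P) / M ^ 2 := by
  have hm := fun a => (memLp_rootSum hident (hg a) (h2 a) n).integrable_sq
  have h := mul_meas_ge_le_integral_of_nonneg (μ := P) (f := fun ω => ∑ a, rootSum D (g a) n ω ^ 2)
    (.of_forall fun _ => Finset.sum_nonneg fun _ _ => sq_nonneg _)
    (integrable_finsetSum _ fun a _ => hm a) (M ^ 2)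
  have hset : {ω | M ≤ ‖WithLp.toLp 2 fun a => rootSum D (g a) n ω‖} =
      {ω | M ^ 2 ≤ ∑ a, rootSum D (g a) n ω ^ 2} := by
    ext ω
    simp only [Set.mem_ofPred_eq]
    rw [← pow_le_pow_iff_left₀ hM.le (norm_nonneg _) two_ne_zero, EuclideanSpace.real_norm_sq_eq]
  rw [hset, le_div_iff₀ (by positivity), mul_comm]
  refine h.trans ?_
  rw [integral_finsetSum _ fun a _ => hm a]
  exact Finset.sum_le_sum fun a _ => integral_rootSum_sq_le hindep hident (hg a) (h2 a) (h0 a) n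

/-- **Asymptotic linearity of the Huber estimator**: the rescaled estimation error is the
normalized sum of the scores premultiplied by `U⁻¹`, up to a term negligible in probability. -/
theorem tendstoInMeasure_huber_linearization [DecidableEq ι] (hk : 0 < k) (hindep : iIndepFun D P)
    (hident : ∀ i, IdentDistrib (D i) D₀ P P)
    {W : 𝓧 → EuclideanSpace ℝ ι} {r : 𝓧 → ℝ} (hW : Measurable W) (hr : Measurable r)
    (hW2 : ∀ a, MemLp (fun ω => W (D₀ ω) a) 2 P) (hatom : ∀ᵐ ω ∂P, |r (D₀ ω)| ≠ k)
    {U : Matrix ι ι ℝ} (hUpos : U.PosDef)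
    (hU : ∀ a b, ∫ ω, (if |r (D₀ ω)| < k then 1 else 0) * (W (D₀ ω) a * W (D₀ ω) b) ∂P = U a b)
    (hscore : ∀ a, ∫ ω, psi k (r (D₀ ω)) * W (D₀ ω) a ∂P = 0)
    {T : ℕ → Ω → EuclideanSpace ℝ ι}
    (hT : ∀ n, ∀ᵐ ω ∂P, ∀ t, ∑ i ∈ Finset.range n, rho k (r (D i ω) - inner ℝ (W (D i ω)) (T n ω))
      ≤ ∑ i ∈ Finset.range n, rho k (r (D i ω) - inner ℝ (W (D i ω)) t)) :
    TendstoInMeasure P (fun (n : ℕ) ω => √(n : ℝ) • T n ω -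
      WithLp.toLp 2 fun a => rootSum D
        (fun d => U⁻¹.mulVec (fun b => psi k (r d) * W d b) a) n ω) atTop fun _ => 0 := by
  have hD₀ : AEMeasurable D₀ P := (hident 0).aemeasurable_snd
  have hWm : AEMeasurable (fun ω => W (D₀ ω)) P := hW.comp_aemeasurable hD₀
  have hrm : AEMeasurable (fun ω => r (D₀ ω)) P := hr.comp_aemeasurable hD₀
  have hpsi : Measurable (psi k) := continuous_psi.measurable
  set g : ι → 𝓧 → ℝ := fun a d => U⁻¹.mulVec (fun b => psi k (r d) * W d b) a with hgdef
  have hs2 : ∀ b, MemLp (fun ω => psi k (r (D₀ ω)) * W (D₀ ω) b) 2 P := fun b =>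
    (hW2 b).of_le_mul (c := k) (by fun_prop) (.of_forall fun ω => by
      rw [norm_mul]
      exact mul_le_mul_of_nonneg_right (abs_psi_le hk _) (norm_nonneg _))
  have hg : ∀ a, Measurable (g a) := fun a => by
    simp only [hgdef, Matrix.mulVec, dotProduct]
    fun_prop
  have hg2 : ∀ a, MemLp (fun ω => g a (D₀ ω)) 2 P := fun a => by
    simp only [hgdef, Matrix.mulVec, dotProduct]
    exact memLp_finsetSum _ fun b _ => (hs2 b).const_mul _
  have hg0 : ∀ a, ∫ ω, g a (D₀ ω) ∂P = 0 := fun a => by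
    simp only [hgdef, Matrix.mulVec, dotProduct]
    rw [integral_finsetSum _ fun b _ => ((hs2 b).integrable one_le_two).const_mul _]
    simp [integral_const_mul, hscore]
  set t₀ : ℕ → Ω → EuclideanSpace ℝ ι := fun n ω => WithLp.toLp 2 fun a => rootSum D (g a) n ω
  -- This is the normal equation: `t₀` is the exact minimizer of the approximating quadratic.
  have hz : ∀ n ω, U.mulVec (t₀ n ω : ι → ℝ) =
      fun a => (√(n : ℝ))⁻¹ * ∑ i ∈ Finset.range n, psi k (r (D i ω)) * W (D i ω) a :=
    fun n ω => by
      have h1 : (t₀ n ω : ι → ℝ) = U⁻¹.mulVec fun a =>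
          (√(n : ℝ))⁻¹ * ∑ i ∈ Finset.range n, psi k (r (D i ω)) * W (D i ω) a := by
        ext a
        simp only [t₀, rootSum, hgdef, Matrix.mulVec, dotProduct]
        rw [Finset.sum_comm, Finset.mul_sum]
        refine Finset.sum_congr rfl fun b _ => ?_
        rw [← Finset.mul_sum]
        ring
      have hdet : IsUnit U.det := (Matrix.isUnit_iff_isUnit_det U).1 hUpos.isUnit
      rw [h1, Matrix.mulVec_mulVec, Matrix.mul_nonsing_inv _ hdet, Matrix.one_mulVec]
  have hsymm : U.IsSymm := by simpa using hUpos.isHermitian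
  obtain ⟨c, hc, hcU⟩ := exists_pos_mul_norm_sq_le hUpos
  set rem : ℝ → ℕ → Ω → ℝ := fun M n ω =>
    M ^ 2 * ((n : ℝ)⁻¹ * ∑ i ∈ Finset.range n, kinkMass k M n (W (D i ω)) (r (D i ω))) +
      M ^ 2 * ∑ a, ∑ b, |(n : ℝ)⁻¹ * ∑ i ∈ Finset.range n,
        (if |r (D i ω)| < k then 1 else 0) * (W (D i ω) a * W (D i ω) b) - U a b|
  have hrem : ∀ M, TendstoInMeasure P (rem M) atTop fun _ => 0 := fun M => by
    refine tendstoInMeasure_add_zero (tendstoInMeasure_const_mul_zero _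
      (tendstoInMeasure_average_kinkMass hident hW hr ?_ hatom M))
      (tendstoInMeasure_const_mul_zero _ (tendstoInMeasure_sum_zero _ fun a _ =>
        tendstoInMeasure_sum_zero _ fun b _ => ?_))
    · simp only [EuclideanSpace.real_norm_sq_eq]
      exact integrable_finsetSum _ fun a _ => (hW2 a).integrable_sq
    · have hfm : Measurable fun d => (if |r d| < k then (1 : ℝ) else 0) * (W d a * W d b) :=
        (Measurable.ite (measurableSet_lt (by fun_prop) measurable_const) measurable_const
          measurable_const).mul (by fun_prop)
      have hfi : Integrable (fun ω => (if |r (D₀ ω)| < k then (1 : ℝ) else 0) *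
          (W (D₀ ω) a * W (D₀ ω) b)) P :=
        ((hW2 a).integrable_mul (hW2 b)).mono (hfm.comp_aemeasurable hD₀).aestronglyMeasurable
          (.of_forall fun ω => by
            rw [norm_mul]
            exact mul_le_of_le_one_left (norm_nonneg _) (by split_ifs <;> simp))
      have := tendstoInMeasure_average hindep hident hfm hfi
      rw [hU] at this
      exact tendstoInMeasure_zero_of_norm_le this
        (.of_forall fun n => .of_forall fun ω => by simp)
  -- on the event where the linear term and the remainder are controlled, the argmin is close
  have hkey : ∀ δ, 0 < δ → ∀ M, 0 < M → ∀ n : ℕ, 0 < n → ∀ᵐ ω ∂P,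
      δ ≤ ‖√(n : ℝ) • T n ω - t₀ n ω‖ →
        M ≤ ‖t₀ n ω‖ ∨ c * δ ^ 2 / 4 ≤ ‖rem (M + δ) n ω‖ := by
    intro δ hδ M hM n hn
    filter_upwards [hT n] with ω hω hfar
    by_contra! hcon
    obtain ⟨h1, h2⟩ := hcon
    have hsq : (0 : ℝ) < √(n : ℝ) := by positivity
    refine absurd hfar (not_le.2 ?_)
    -- The ball of radius `M + δ` contains the `δ`-neighbourhood of `t₀`. The modulus is `c / 2`
    -- because the form is halved, and a remainder below `c δ² / 4` is what `2 R < (c / 2) δ²`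
    -- requires.
    refine norm_sub_lt_of_convex_of_close (M := M + δ) (R := rem (M + δ) n ω) (c := c / 2)
      (A := fun t => ∑ i ∈ Finset.range n, (rho k (r (D i ω) -
        inner ℝ (W (D i ω)) ((√(n : ℝ))⁻¹ • t)) - rho k (r (D i ω))))
      (q := fun t => ((t : ι → ℝ) ⬝ᵥ U.mulVec (t : ι → ℝ)) / 2 -
        (fun a => (√(n : ℝ))⁻¹ * ∑ i ∈ Finset.range n, psi k (r (D i ω)) * W (D i ω) a) ⬝ᵥ
          (t : ι → ℝ)) ?_ ?_ ?_ ?_ hδ (by linarith) ?_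
    · refine ⟨convex_univ, fun s _ t _ a b ha hb hab => ?_⟩
      simp only [smul_eq_mul, Finset.mul_sum, ← Finset.sum_add_distrib]
      refine Finset.sum_le_sum fun i _ => ?_
      have h3 := (convexOn_rho hk).2 (Set.mem_univ (r (D i ω) -
        inner ℝ (W (D i ω)) ((√(n : ℝ))⁻¹ • s))) (Set.mem_univ (r (D i ω) -
        inner ℝ (W (D i ω)) ((√(n : ℝ))⁻¹ • t))) ha hb hab
      simp only [smul_eq_mul] at h3
      have h4 : r (D i ω) - inner ℝ (W (D i ω)) ((√(n : ℝ))⁻¹ • (a • s + b • t)) =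
          a * (r (D i ω) - inner ℝ (W (D i ω)) ((√(n : ℝ))⁻¹ • s)) +
          b * (r (D i ω) - inner ℝ (W (D i ω)) ((√(n : ℝ))⁻¹ • t)) := by
        simp only [inner_smul_right, inner_add_right]
        linear_combination (-r (D i ω)) * hab
      rw [h4]
      linear_combination h3 + rho k (r (D i ω)) * hab
    · intro t
      simp only [Finset.sum_sub_distrib]
      rw [inv_smul_smul₀ hsq.ne']
      exact sub_le_sub_right (hω _) _
    · intro t ht
      exact abs_objective_sub_quadratic_le hk hn (fun i => W (D i ω)) (fun i => r (D i ω)) U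
        (by linarith) ht
    · intro t
      have h5 := quadratic_sub_eq hsymm (hz n ω) (t : ι → ℝ)
      have h6 := hcU (t - t₀ n ω)
      rw [WithLp.ofLp_sub] at h6
      simp only
      rw [h5]
      linarith
    · have := (le_abs_self _).trans_lt h2
      linarith
  rw [tendstoInMeasure_zero_iff]
  intro δ hδ
  set C := ∑ a, ∫ ω, g a (D₀ ω) ^ 2 ∂P
  have hC : 0 ≤ C := Finset.sum_nonneg fun a _ => integral_nonneg fun _ => sq_nonneg _
  rw [ENNReal.tendsto_nhds_zero]
  intro η hη
  -- A finite stand-in for `η`, which may be `⊤`.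
  obtain ⟨ζ, hζ0, hζ⟩ : ∃ ζ : ℝ, 0 < ζ ∧ ENNReal.ofReal ζ ≤ η := by
    rcases eq_or_ne η ⊤ with rfl | hne
    · exact ⟨1, one_pos, le_top⟩
    · exact ⟨η.toReal, ENNReal.toReal_pos hη.ne' hne, (ENNReal.ofReal_toReal hne).le⟩
  -- `M` makes the Chebyshev bound at most `ζ / 2`; `C + 1` keeps it positive when `C = 0`.
  obtain ⟨M, hM, hMC⟩ : ∃ M : ℝ, 0 < M ∧ C / M ^ 2 ≤ ζ / 2 := by
    refine ⟨√((C + 1) * 2 / ζ), by positivity, ?_⟩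
    rw [Real.sq_sqrt (by positivity), div_le_iff₀ (by positivity)]
    field_simp
    linarith
  have hev := (tendstoInMeasure_zero_iff.1 (hrem (M + δ)) (c * δ ^ 2 / 4) (by positivity))
  rw [ENNReal.tendsto_nhds_zero] at hev
  filter_upwards [hev (ENNReal.ofReal (ζ / 2)) (by simpa using hζ0), eventually_gt_atTop 0]
    with n hn hn0
  calc P {ω | δ ≤ ‖√(n : ℝ) • T n ω - t₀ n ω‖}
      ≤ P ({ω | M ≤ ‖t₀ n ω‖} ∪ {ω | c * δ ^ 2 / 4 ≤ ‖rem (M + δ) n ω‖}) :=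
        measure_mono_ae (hkey δ hδ M hM n hn0)
    _ ≤ P {ω | M ≤ ‖t₀ n ω‖} + P {ω | c * δ ^ 2 / 4 ≤ ‖rem (M + δ) n ω‖} := measure_union_le _ _
    _ ≤ ENNReal.ofReal (ζ / 2) + ENNReal.ofReal (ζ / 2) := by
        gcongr
        rw [← ENNReal.ofReal_toReal (measure_ne_top P _)]
        exact ENNReal.ofReal_le_ofReal
          ((measure_norm_rootSum_ge_le hindep hident hg hg2 hg0 n hM).trans hMC)
    _ = ENNReal.ofReal ζ := by
        rw [← ENNReal.ofReal_add (by positivity) (by positivity), add_halves]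
    _ ≤ η := hζ

end Linearization

/-! ### Moments of the joint score. -/

section Population

variable {Ω : Type*} [MeasurableSpace Ω] {P : Measure Ω}
  {p : ℕ} {k : ℝ} {X : Ω → EuclideanSpace ℝ (Fin p)} {e : Ω → ℝ}

/-- The joint score of one observation `(x, ε)`, with location `m` and scatter `S`. -/
noncomputable def score (k : ℝ) (m : EuclideanSpace ℝ (Fin p)) (S : Matrix (Fin p) (Fin p) ℝ)
    (d : EuclideanSpace ℝ (Fin p) × ℝ) : ParamIdx p → ℝ :=
  Sum.elim (fun a => psi k d.2 * design d.1 a)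
    (Sum.elim (fun ij => vech (outer fun j => (d.1 - m) j) ij - vech S ij) fun j => (d.1 - m) j)

lemma measurable_design (a : RegIdx p) :
    Measurable fun x : EuclideanSpace ℝ (Fin p) => design x a := by
  rcases a with a | j
  · exact measurable_const
  · simp only [design, Sum.elim_inr]
    fun_prop

lemma measurable_score (k : ℝ) (m : EuclideanSpace ℝ (Fin p)) (S : Matrix (Fin p) (Fin p) ℝ)
    (a : ParamIdx p) : Measurable fun d => score k m S d a := by
  rcases a with a | ij | j
  · simp only [score, Sum.elim_inl]
    exact (continuous_psi.measurable.comp measurable_snd).mul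
      ((measurable_design a).comp measurable_fst)
  · simp only [score, Sum.elim_inr, Sum.elim_inl, vech, outer, Matrix.vecMulVec_apply]
    fun_prop
  · simp only [score, Sum.elim_inr]
    fun_prop

lemma memLp_four_coord (hX : Measurable X) (hmom : Integrable (fun ω => ‖X ω‖ ^ 4) P)
    (j : Fin p) : MemLp (fun ω => X ω j) 4 P := by
  have h : MemLp X 4 P := by
    refine (integrable_norm_rpow_iff hX.aestronglyMeasurable (by norm_num) (by norm_num)).1 ?_
    convert hmom using 2 with ω
    norm_num
  exact h.of_le (by fun_prop) (.of_forall fun ω => PiLp.norm_apply_le (X ω) j)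

lemma muX_apply (hX1 : ∀ j, Integrable (fun ω => X ω j) P) (j : Fin p) :
    muX X P j = ∫ ω, X ω j ∂P :=
  eval_integral_piLp hX1 j

lemma SigmaX_apply (hX1 : ∀ j, Integrable (fun ω => X ω j) P) (i j : Fin p) :
    SigmaX X P i j = ∫ ω, (X ω - muX X P) i * (X ω - muX X P) j ∂P := by
  simp only [SigmaX, covMat, Matrix.of_apply, covariance, PiLp.sub_apply, muX_apply hX1]

lemma integral_indicator_mul_design (hk : 0 < k) (hatom : ∀ᵐ ω ∂P, |e ω| ≠ k) (a b : RegIdx p) :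
    ∫ ω, (if |e ω| < k then 1 else 0) * (design (X ω) a * design (X ω) b) ∂P = U11 k X e P a b := by
  refine integral_congr_ae ?_
  filter_upwards [hatom] with ω hω
  simp only [deriv_psi_of_abs_ne hk hω, outer, Matrix.vecMulVec_apply]

lemma inv_U1 (hU : IsUnit (U11 k X e P)) :
    (U1 k X e P)⁻¹ = Matrix.fromBlocks (U11 k X e P)⁻¹ 0 0 1 := by
  refine Matrix.inv_eq_right_inv ?_
  rw [U1, Matrix.fromBlocks_one, Matrix.fromBlocks_multiply, Matrix.mul_nonsing_inv _
    ((Matrix.isUnit_iff_isUnit_det _).1 hU)]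
  simp

/-- Lets the covariance `U⁻¹ V U⁻ᵀ` of the influence function be written `U⁻¹ V U⁻¹`. -/
lemma transpose_inv_U1 : ((U1 k X e P)⁻¹).transpose = (U1 k X e P)⁻¹ := by
  rw [Matrix.transpose_nonsing_inv]
  congr 1
  have h : (U11 k X e P).transpose = U11 k X e P := by
    ext a b
    simp only [Matrix.transpose_apply, U11, Matrix.of_apply, outer, Matrix.vecMulVec_apply]
    simp_rw [mul_comm (design _ a)]
  rw [U1, Matrix.fromBlocks_one, Matrix.fromBlocks_transpose, h]
  simp

variable [IsProbabilityMeasure P]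

lemma memLp_design (hX2 : ∀ j, MemLp (fun ω => X ω j) 2 P) (a : RegIdx p) :
    MemLp (fun ω => design (X ω) a) 2 P := by
  rcases a with a | j
  · exact memLp_const 1
  · exact hX2 j

lemma integral_sub_muX (hX1 : ∀ j, Integrable (fun ω => X ω j) P) (j : Fin p) :
    ∫ ω, (X ω - muX X P) j ∂P = 0 := by
  simp only [PiLp.sub_apply]
  rw [integral_sub (hX1 j) (integrable_const _), muX_apply hX1]
  simp

/-- A conditionally centered influence function is orthogonal to functions of the regressor. -/
lemma integral_psi_mul_eq_zero (hk : 0 < k) (hX : Measurable X) (he : Measurable e)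
    (hcond : P[fun ω => psi k (e ω) | MeasurableSpace.comap X inferInstance] =ᵐ[P] 0)
    {h : EuclideanSpace ℝ (Fin p) → ℝ} (hh : Measurable h)
    (hint : Integrable (fun ω => h (X ω)) P) :
    ∫ ω, psi k (e ω) * h (X ω) ∂P = 0 := by
  have hpsi : Measurable fun ω => psi k (e ω) := continuous_psi.measurable.comp he
  have hb : ∀ ω, ‖psi k (e ω)‖ ≤ k := fun ω => abs_psi_le hk _
  have hprod : Integrable ((fun ω => h (X ω)) * fun ω => psi k (e ω)) P :=
    hint.mul_bdd hpsi.aestronglyMeasurable (.of_forall hb)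
  have hpi : Integrable (fun ω => psi k (e ω)) P :=
    Integrable.of_bound hpsi.aestronglyMeasurable k (.of_forall hb)
  have hsm : StronglyMeasurable[MeasurableSpace.comap X inferInstance] fun ω => h (X ω) :=
    (hh.comp (comap_measurable X)).stronglyMeasurable
  have hpull := condExp_mul_of_stronglyMeasurable_left hsm hprod hpi
  calc ∫ ω, psi k (e ω) * h (X ω) ∂P
      = ∫ ω, ((fun ω => h (X ω)) * fun ω => psi k (e ω)) ω ∂P := by
        simp only [Pi.mul_apply, mul_comm]
    _ = ∫ ω, (P[(fun ω => h (X ω)) * fun ω => psi k (e ω) |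
          MeasurableSpace.comap X inferInstance]) ω ∂P := (integral_condExp hX.comap_le).symm
    _ = ∫ ω, (0 : ℝ) ∂P := by
        refine integral_congr_ae ?_
        filter_upwards [hpull, hcond] with ω h1 h2
        rw [h1, Pi.mul_apply, h2]
        simp
    _ = 0 := by simp

/-- An indicator equals its square, so `U11` is the second moment matrix of `1{|ε| < k} w`, hence
semidefinite; nonsingularity makes it definite, as the argmin argument requires. -/
lemma posDef_U11 (hk : 0 < k) (he : Measurable e) (hX : Measurable X)
    (hX2 : ∀ j, MemLp (fun ω => X ω j) 2 P)
    (hatom : ∀ᵐ ω ∂P, |e ω| ≠ k) (hU : IsUnit (U11 k X e P)) : (U11 k X e P).PosDef := by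
  refine (Matrix.PosSemidef.posDef_iff_isUnit ?_).2 hU
  have hI : Measurable fun ω => if |e ω| < k then (1 : ℝ) else 0 :=
    Measurable.ite (measurableSet_lt (by fun_prop) measurable_const) measurable_const
      measurable_const
  refine posSemidef_of_second_moments (P := P)
    (Y := fun ω a => (if |e ω| < k then 1 else 0) * design (X ω) a) (fun a => ?_) fun a b => ?_
  · refine (memLp_design hX2 a).of_le
      (hI.mul ((measurable_design a).comp hX)).aestronglyMeasurable (.of_forall fun ω => ?_)
    rw [norm_mul]
    exact mul_le_of_le_one_left (norm_nonneg _) (by split_ifs <;> simp)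
  · rw [← integral_indicator_mul_design hk hatom]
    refine integral_congr_ae (.of_forall fun ω => ?_)
    simp only
    split_ifs <;> ring

/-- Hölder with `1/4 + 1/4 = 1/2`; the fourth moment is needed here. -/
lemma memLp_centered_mul (hX4 : ∀ j, MemLp (fun ω => X ω j) 4 P) (i j : Fin p) :
    MemLp (fun ω => (X ω - muX X P) i * (X ω - muX X P) j) 2 P := by
  have h : ∀ j, MemLp (fun ω => (X ω - muX X P) j) 4 P := fun j => (hX4 j).sub (memLp_const _)
  have : ENNReal.HolderTriple 4 4 2 := ⟨by
    rw [← two_mul, show (4 : ENNReal) = 2 * 2 by norm_num, ENNReal.mul_inv (by simp) (by simp),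
      ← mul_assoc, ENNReal.mul_inv_cancel (by simp) (by simp), one_mul]⟩
  exact (h j).mul' (h i)

lemma memLp_score (hX4 : ∀ j, MemLp (fun ω => X ω j) 4 P) (hk : 0 < k)
    (hX : Measurable X) (he : Measurable e) (a : ParamIdx p) :
    MemLp (fun ω => score k (muX X P) (SigmaX X P) (X ω, e ω) a) 2 P := by
  have hX2 : ∀ j, MemLp (fun ω => X ω j) 2 P := fun j => (hX4 j).mono_exponent (by norm_num)
  rcases a with a | ij | j
  · refine (memLp_design hX2 a).of_le_mul (c := k)
      ((measurable_score k (muX X P) (SigmaX X P) (.inl a)).comp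
        (hX.prodMk he)).aestronglyMeasurable (.of_forall fun ω => ?_)
    simp only [score, Sum.elim_inl, norm_mul]
    exact mul_le_mul_of_nonneg_right (abs_psi_le hk _) (norm_nonneg _)
  · exact (memLp_centered_mul hX4 ij.1.1 ij.1.2).sub (memLp_const _)
  · exact (hX2 j).sub (memLp_const _)

lemma integral_score (hX4 : ∀ j, MemLp (fun ω => X ω j) 4 P) (hk : 0 < k)
    (hX : Measurable X) (he : Measurable e)
    (hcond : P[fun ω => psi k (e ω) | MeasurableSpace.comap X inferInstance] =ᵐ[P] 0)
    (a : ParamIdx p) :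
    ∫ ω, score k (muX X P) (SigmaX X P) (X ω, e ω) a ∂P = 0 := by
  have hX2 : ∀ j, MemLp (fun ω => X ω j) 2 P := fun j => (hX4 j).mono_exponent (by norm_num)
  have hX1 : ∀ j, Integrable (fun ω => X ω j) P := fun j => (hX2 j).integrable one_le_two
  rcases a with a | ij | j
  · exact integral_psi_mul_eq_zero hk hX he hcond (measurable_design a)
      ((memLp_design hX2 a).integrable one_le_two)
  · simp only [score, Sum.elim_inr, Sum.elim_inl, vech, outer, Matrix.vecMulVec_apply]
    rw [integral_sub ((memLp_centered_mul hX4 _ _).integrable one_le_two) (integrable_const _),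
      SigmaX_apply hX1]
    simp
  · exact integral_sub_muX hX1 j

/-- The second moments of the joint score are the entries of `V1`. -/
lemma integral_score_mul_score (hX4 : ∀ j, MemLp (fun ω => X ω j) 4 P) (hk : 0 < k)
    (hX : Measurable X) (he : Measurable e)
    (hcond : P[fun ω => psi k (e ω) | MeasurableSpace.comap X inferInstance] =ᵐ[P] 0)
    (a b : ParamIdx p) :
    ∫ ω, score k (muX X P) (SigmaX X P) (X ω, e ω) a *
      score k (muX X P) (SigmaX X P) (X ω, e ω) b ∂P = V1 k X e P a b := by
  have hX2 : ∀ j, MemLp (fun ω => X ω j) 2 P := fun j => (hX4 j).mono_exponent (by norm_num)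
  have hX1 : ∀ j, Integrable (fun ω => X ω j) P := fun j => (hX2 j).integrable one_le_two
  have hXc : ∀ j, MemLp (fun ω => (X ω - muX X P) j) 2 P := fun j => (hX2 j).sub (memLp_const _)
  -- scores of the regression part are orthogonal to functions of the regressor alone
  have hcross : ∀ (a : RegIdx p) (b : VechIdx p ⊕ Fin p),
      ∫ ω, score k (muX X P) (SigmaX X P) (X ω, e ω) (.inl a) *
        score k (muX X P) (SigmaX X P) (X ω, e ω) (.inr b) ∂P = 0 := by
    intro a b
    -- The covariance and mean scores do not involve `ε`, so putting `0` in its place exhibits a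
    -- function of `x` alone.
    have hm : Measurable fun x : EuclideanSpace ℝ (Fin p) =>
        design x a * score k (muX X P) (SigmaX X P) (x, 0) (.inr b) :=
      (measurable_design a).mul ((measurable_score k (muX X P) (SigmaX X P) (.inr b)).comp
        (measurable_id.prodMk measurable_const))
    have hi := (memLp_design hX2 a).integrable_mul (memLp_score hX4 hk hX he (.inr b))
    have := integral_psi_mul_eq_zero hk hX he hcond hm hi
    simp only [← mul_assoc] at this
    exact this
  have hvech : ∀ ij : VechIdx p, ∫ ω, vechSq X P ω ij ∂P = SigmaX X P ij.1.1 ij.1.2 := fun ij => by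
    rw [SigmaX_apply hX1]
    rfl
  have hvj : ∀ (ij : VechIdx p) (j : Fin p),
      ∫ ω, score k (muX X P) (SigmaX X P) (X ω, e ω) (.inr (.inl ij)) *
        score k (muX X P) (SigmaX X P) (X ω, e ω) (.inr (.inr j)) ∂P = V23 X P ij j := by
    intro ij j
    -- Centering the `vech` factor changes nothing, since `X - μ` has mean zero.
    have h1 : ∀ ω, score k (muX X P) (SigmaX X P) (X ω, e ω) (.inr (.inl ij)) *
        score k (muX X P) (SigmaX X P) (X ω, e ω) (.inr (.inr j)) =
        vechSq X P ω ij * (X ω - muX X P) j -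
          SigmaX X P ij.1.1 ij.1.2 * (X ω - muX X P) j := fun ω => sub_mul _ _ _
    have hi : Integrable (fun ω => vechSq X P ω ij * (X ω - muX X P) j) P :=
      (memLp_centered_mul hX4 ij.1.1 ij.1.2).integrable_mul (hXc j)
    simp_rw [h1]
    rw [integral_sub hi (((hXc j).integrable one_le_two).const_mul _), integral_const_mul,
      integral_sub_muX hX1]
    simp [V23]
  rcases a with a | a | a <;> rcases b with b | b | b
  · simp only [V1, Matrix.fromBlocks_apply₁₁, V11, Matrix.of_apply]
    refine integral_congr_ae (.of_forall fun ω => ?_)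
    simp only [score, Sum.elim_inl, outer, Matrix.vecMulVec_apply]
    ring
  · exact hcross a (.inl b)
  · exact hcross a (.inr b)
  · simp_rw [mul_comm]
    exact hcross b (.inl a)
  · simp only [V1, Matrix.fromBlocks_apply₂₂, Matrix.fromBlocks_apply₁₁, V22, covMat,
      Matrix.of_apply, covariance, hvech]
    rfl
  · exact hvj a b
  · simp_rw [mul_comm]
    exact hcross b (.inr a)
  · simp_rw [mul_comm]
    exact hvj b a
  · simp only [V1, Matrix.fromBlocks_apply₂₂, SigmaX_apply hX1]
    rfl

end Population

/-! ### Sample moments, and the fit in terms of the errors. -/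

/-- Centering at the sample means costs the sample covariance a product of normalized sums. -/
lemma sqrt_mul_sampleCov_sub {n : ℕ} (hn : 0 < n) (u v : ℕ → ℝ) (a b s : ℝ) :
    √(n : ℝ) * ((n : ℝ)⁻¹ * ∑ i ∈ Finset.range n, (u i - (n : ℝ)⁻¹ * ∑ l ∈ Finset.range n, u l) *
        (v i - (n : ℝ)⁻¹ * ∑ l ∈ Finset.range n, v l) - s) -
      (√(n : ℝ))⁻¹ * ∑ i ∈ Finset.range n, ((u i - a) * (v i - b) - s) =
    -((√(n : ℝ))⁻¹ * (((√(n : ℝ))⁻¹ * ∑ i ∈ Finset.range n, (u i - a)) *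
      ((√(n : ℝ))⁻¹ * ∑ i ∈ Finset.range n, (v i - b)))) := by
  have hq : (0 : ℝ) < √(n : ℝ) := by positivity
  have hnq : (n : ℝ) = √(n : ℝ) ^ 2 := (Real.sq_sqrt (by positivity)).symm
  have hexp : ∀ c d : ℝ, ∑ i ∈ Finset.range n, (u i - c) * (v i - d) =
      ∑ i ∈ Finset.range n, u i * v i - d * ∑ i ∈ Finset.range n, u i -
        c * ∑ i ∈ Finset.range n, v i + n * (c * d) := fun c d => by
    have : ∀ i, (u i - c) * (v i - d) = u i * v i - d * u i - c * v i + c * d := fun i => by ring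
    simp [this, Finset.sum_add_distrib, Finset.sum_sub_distrib, Finset.mul_sum]
  rw [Finset.sum_sub_distrib, hexp, hexp, Finset.sum_sub_distrib, Finset.sum_sub_distrib]
  simp only [Finset.sum_const, Finset.card_range, nsmul_eq_mul]
  -- With `n = q²` the claim is a rational identity.
  generalize √(n : ℝ) = q at hq hnq
  rw [hnq]
  field_simp
  ring

section Sample

variable {p : ℕ}

lemma inner_design (x : EuclideanSpace ℝ (Fin p)) (t : EuclideanSpace ℝ (RegIdx p)) :
    inner ℝ (WithLp.toLp 2 (design x)) t =
      t (.inl ()) + inner ℝ x (WithLp.toLp 2 fun j => t (.inr j)) := by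
  simp [PiLp.inner_apply, design]

/-- The estimation error of a Huber fit minimizes the objective written in the true errors. -/
lemma IsHuberFit.sum_rho_le {k : ℝ} {n : ℕ} {y ε : ℕ → ℝ} {x : ℕ → EuclideanSpace ℝ (Fin p)}
    {m m₀ : ℝ} {b b₀ : EuclideanSpace ℝ (Fin p)} (h : IsHuberFit k n y x m b)
    (hy : ∀ i, y i = m₀ + inner ℝ (x i) b₀ + ε i) (t : EuclideanSpace ℝ (RegIdx p)) :
    ∑ i ∈ Finset.range n, rho k (ε i - inner ℝ (WithLp.toLp 2 (design (x i)))
        (WithLp.toLp 2 (Sum.elim (fun _ => m - m₀) fun j => (b - b₀) j)))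
      ≤ ∑ i ∈ Finset.range n, rho k (ε i - inner ℝ (WithLp.toLp 2 (design (x i))) t) := by
  have hl : ∀ i, ε i - inner ℝ (WithLp.toLp 2 (design (x i)))
      (WithLp.toLp 2 (Sum.elim (fun _ => m - m₀) fun j => (b - b₀) j)) =
      y i - m - inner ℝ (x i) b := fun i => by
    have hb : inner ℝ (x i) (WithLp.toLp 2 fun j => (b - b₀) j) =
        inner ℝ (x i) b - inner ℝ (x i) b₀ := inner_sub_right _ _ _
    rw [inner_design]
    simp only [Sum.elim_inl, Sum.elim_inr]
    rw [hb, hy]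
    ring
  have hr : ∀ i, ε i - inner ℝ (WithLp.toLp 2 (design (x i))) t =
      y i - (m₀ + t (.inl ())) - inner ℝ (x i) (b₀ + WithLp.toLp 2 fun j => t (.inr j)) :=
    fun i => by
      rw [inner_design, inner_add_right, hy]
      ring
  simp only [hl, hr]
  exact h _ _

lemma sampleMean_apply (n : ℕ) (x : ℕ → EuclideanSpace ℝ (Fin p)) (j : Fin p) :
    sampleMean n x j = (n : ℝ)⁻¹ * ∑ i ∈ Finset.range n, x i j := by
  simp [sampleMean]

lemma sampleCov_apply (n : ℕ) (x : ℕ → EuclideanSpace ℝ (Fin p)) (j l : Fin p) :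
    sampleCov n x j l = (n : ℝ)⁻¹ * ∑ i ∈ Finset.range n,
      (x i j - sampleMean n x j) * (x i l - sampleMean n x l) := by
  simp [sampleCov, outer, Matrix.sum_apply, Matrix.vecMulVec_apply]

end Sample

end HuberReg

/-! ### Assembly of the joint limit. -/

theorem theorem1 {Ω : Type*} [MeasurableSpace Ω] (P : Measure Ω) [IsProbabilityMeasure P]
    (p : ℕ) (k : ℝ) (hk : 0 < k)
    (muStar : ℝ) (betaStar : EuclideanSpace ℝ (Fin p))
    -- the generic pair `(x, ε)`
    (X : Ω → EuclideanSpace ℝ (Fin p)) (e : Ω → ℝ) (hX : Measurable X) (he : Measurable e)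
    -- the sample
    (x : ℕ → Ω → EuclideanSpace ℝ (Fin p)) (eps y : ℕ → Ω → ℝ)
    (hx : ∀ i, Measurable (x i)) (heps : ∀ i, Measurable (eps i))
    (hy : ∀ i ω, y i ω = muStar + inner ℝ (x i ω) betaStar + eps i ω)
    (hindep : iIndepFun (fun i ω => (x i ω, eps i ω)) P)
    (hident : ∀ i, IdentDistrib (fun ω => (x i ω, eps i ω)) (fun ω => (X ω, e ω)) P P)
    -- `E[ψ(ε) | x] = 0`
    (hcond : P[fun ω => HuberReg.psi k (e ω) | MeasurableSpace.comap X inferInstance] =ᵐ[P] 0)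
    -- `x` has finite fourth moments and a positive definite covariance matrix
    (hmom : Integrable (fun ω => ‖X ω‖ ^ 4) P)
    (hpos : (HuberReg.SigmaX X P).PosDef)
    -- `ψ'(ε)` exists almost surely, and `E[ψ'(ε) w wᵀ]` is nonsingular
    (hatom : ∀ᵐ ω ∂P, |e ω| ≠ k)
    (hU : IsUnit (HuberReg.U11 k X e P))
    -- the Huber fit
    (muHat : ℕ → Ω → ℝ) (betaHat : ℕ → Ω → EuclideanSpace ℝ (Fin p))
    (hmuHat : ∀ n, AEMeasurable (muHat n) P) (hbetaHat : ∀ n, AEMeasurable (betaHat n) P)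
    (hfit : ∀ n, ∀ᵐ ω ∂P, HuberReg.IsHuberFit k n (fun i => y i ω) (fun i => x i ω)
      (muHat n ω) (betaHat n ω)) :
    ((HuberReg.U1 k X e P)⁻¹ * HuberReg.V1 k X e P * (HuberReg.U1 k X e P)⁻¹).PosSemidef ∧
    TendstoInDistribution
      (fun (n : ℕ) ω => √(n : ℝ) •
        (HuberReg.joint (muHat n ω) (betaHat n ω)
            (HuberReg.sampleCov n fun i => x i ω) (HuberReg.sampleMean n fun i => x i ω)
          - HuberReg.joint muStar betaStar (HuberReg.SigmaX X P) (HuberReg.muX X P)))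
      atTop
      (id : EuclideanSpace ℝ (HuberReg.ParamIdx p) → EuclideanSpace ℝ (HuberReg.ParamIdx p))
      (fun _ => P)
      (multivariateGaussian 0
        ((HuberReg.U1 k X e P)⁻¹ * HuberReg.V1 k X e P * (HuberReg.U1 k X e P)⁻¹)) := by
  open HuberReg in
  have hX4 := memLp_four_coord hX hmom
  have hX2 : ∀ j, MemLp (fun ω => X ω j) 2 P := fun j => (hX4 j).mono_exponent (by norm_num)
  have hX1 : ∀ j, Integrable (fun ω => X ω j) P := fun j => (hX2 j).integrable one_le_two
  have hUinv := inv_U1 (k := k) (X := X) (e := e) hU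
  have hUtr := transpose_inv_U1 (k := k) (X := X) (e := e) (P := P)
  set U := U1 k X e P
  set V := V1 k X e P
  set m := muX X P
  set S := SigmaX X P
  set D : ℕ → Ω → EuclideanSpace ℝ (Fin p) × ℝ := fun i ω => (x i ω, eps i ω)
  set D₀ : Ω → EuclideanSpace ℝ (Fin p) × ℝ := fun ω => (X ω, e ω)
  -- the influence function
  let Y : EuclideanSpace ℝ (Fin p) × ℝ → EuclideanSpace ℝ (ParamIdx p) := fun d =>
    WithLp.toLp 2 (U⁻¹.mulVec (score k m S d))
  have hYa : ∀ d a, Y d a = U⁻¹ a ⬝ᵥ score k m S d := fun d a => rfl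
  have hs2 : ∀ a, MemLp (fun ω => score k m S (D₀ ω) a) 2 P := memLp_score hX4 hk hX he
  have hYm : Measurable Y := by
    refine (WithLp.measurable_toLp 2 _).comp (measurable_pi_iff.2 fun a => ?_)
    simp only [Matrix.mulVec, dotProduct]
    exact Finset.measurable_fun_sum _ fun b _ => (measurable_score k m S b).const_mul _
  have hY2 : ∀ a, MemLp (fun ω => Y (D₀ ω) a) 2 P := fun a => by
    simp only [hYa, dotProduct]
    exact memLp_finsetSum _ fun b _ => (hs2 b).const_mul _
  have hY0 : ∀ a, ∫ ω, Y (D₀ ω) a ∂P = 0 := fun a => by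
    simp only [hYa, dotProduct]
    rw [integral_finsetSum _ fun b _ => ((hs2 b).integrable one_le_two).const_mul _]
    refine Finset.sum_eq_zero fun b _ => ?_
    rw [integral_const_mul, integral_score hX4 hk hX he hcond b, mul_zero]
  have hYS : ∀ a b, ∫ ω, Y (D₀ ω) a * Y (D₀ ω) b ∂P = (U⁻¹ * V * U⁻¹) a b := fun a b => by
    simp only [hYa]
    rw [integral_dotProduct_mul_dotProduct hs2 (integral_score_mul_score hX4 hk hX he hcond)]
    conv_rhs => rw [← hUtr, hUtr, Matrix.mul_assoc, Matrix.mul_apply]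
    refine Finset.sum_congr rfl fun c _ => ?_
    congr 1
    simp only [Matrix.mulVec, dotProduct, Matrix.mul_apply]
    refine Finset.sum_congr rfl fun d _ => ?_
    -- Symmetry of `U⁻¹` exchanges its row `b` and its column `b`.
    rw [← congrFun (congrFun hUtr d) b, Matrix.transpose_apply]
  refine ⟨posSemidef_of_second_moments (Y := fun ω a => Y (D₀ ω) a) hY2 hYS, ?_⟩
  have hclt := tendstoInDistribution_inv_sqrt_smul_sum hindep hident hYm hY2 hY0 hYS
  -- Slutsky: it remains to show that the distance to the influence sum vanishes in probability,
  -- coordinate by coordinate.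
  refine tendstoInDistribution_of_tendstoInMeasure_sub _ _ hclt ?_ fun n => ?_
  · refine tendstoInMeasure_zero_of_coord fun a => ?_
    have hcoord : ∀ (n : ℕ) ω, ((√(n : ℝ))⁻¹ • ∑ i ∈ Finset.range n, Y (D i ω)) a =
        rootSum D (fun d => Y d a) n ω := fun n ω => by
      simp [rootSum]
    have hblock : ∀ d, U⁻¹.mulVec (score k m S d) = Sum.elim
        ((U11 k X e P)⁻¹.mulVec fun b => psi k d.2 * design d.1 b)
        (fun b => score k m S d (.inr b)) := fun d => by
      rw [hUinv, Matrix.fromBlocks_mulVec]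
      simp only [Matrix.zero_mulVec, Matrix.one_mulVec, add_zero, zero_add]
      rfl
    simp only [Pi.sub_apply, PiLp.sub_apply, hcoord, PiLp.smul_apply, smul_eq_mul]
    rcases a with a | ij | j
    · have hlin := tendstoInMeasure_huber_linearization hk hindep hident
        (W := fun d => WithLp.toLp 2 (design d.1)) (r := fun d => d.2)
        ((WithLp.measurable_toLp 2 _).comp (measurable_pi_iff.2 fun a =>
          (measurable_design a).comp measurable_fst)) measurable_snd
        (memLp_design hX2) hatom (posDef_U11 hk he hX hX2 hatom hU)
        (integral_indicator_mul_design hk hatom)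
        (fun a => integral_psi_mul_eq_zero hk hX he hcond (measurable_design a)
          ((memLp_design hX2 a).integrable one_le_two))
        (T := fun n ω => WithLp.toLp 2 (Sum.elim (fun _ => muHat n ω - muStar)
          fun j => (betaHat n ω - betaStar) j))
        (fun n => (hfit n).mono fun ω hω => hω.sum_rho_le fun i => hy i ω)
      refine tendstoInMeasure_zero_of_norm_le hlin (.of_forall fun n => .of_forall fun ω => ?_)
      refine le_trans (le_of_eq ?_) (PiLp.norm_apply_le _ a)
      congr 1
      simp only [PiLp.sub_apply, PiLp.smul_apply, smul_eq_mul]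
      congr 1
      · congr 1
        rcases a with a | j <;> rfl
      · simp only [Y, hblock, Sum.elim_inl]
    · refine tendstoInMeasure_zero_of_norm_le (tendstoInMeasure_inv_sqrt_mul_rootSum_mul
        hindep hident (f := fun d => (d.1 - m) ij.1.1) (g := fun d => (d.1 - m) ij.1.2)
        (by fun_prop) ((hX2 _).sub (memLp_const _)) (integral_sub_muX hX1 _)
        (by fun_prop) ((hX2 _).sub (memLp_const _)) (integral_sub_muX hX1 _)) ?_
      filter_upwards [eventually_gt_atTop 0] with n hn
      refine .of_forall fun ω => le_of_eq ?_
      have h1 := sqrt_mul_sampleCov_sub hn (fun i => x i ω ij.1.1) (fun i => x i ω ij.1.2)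
        (m ij.1.1) (m ij.1.2) (S ij.1.1 ij.1.2)
      rw [← norm_neg (_ * (_ * _))]
      congr 1
      refine Eq.trans ?_ h1
      simp only [Y, hblock, Sum.elim_inr, rootSum]
      simp only [joint, Sum.elim_inr, Sum.elim_inl, vech, sampleCov_apply, sampleMean_apply]
      rfl
    -- The sample mean is exactly linear: the difference is identically zero, also at `n = 0`, where
    -- both terms vanish.
    · refine tendstoInMeasure_zero_of_norm_le (g := fun _ _ => (0 : ℝ)) ?_
        (.of_forall fun n => .of_forall fun ω => le_of_eq ?_)
      · rw [tendstoInMeasure_zero_iff]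
        intro δ hδ
        simp [not_le.2 hδ]
      · congr 1
        simp only [Y, hblock, Sum.elim_inr, rootSum]
        simp only [joint, score, Sum.elim_inr, sampleMean_apply, D, PiLp.sub_apply,
          Finset.sum_sub_distrib, Finset.sum_const, Finset.card_range, nsmul_eq_mul]
        rcases Nat.eq_zero_or_pos n with rfl | hn
        · simp
        have hq : (0 : ℝ) < √(n : ℝ) := by positivity
        have hnq : (n : ℝ) = √(n : ℝ) ^ 2 := (Real.sq_sqrt (by positivity)).symm
        generalize √(n : ℝ) = q at hq hnq
        rw [hnq]
        field_simp
        ring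
  · refine AEMeasurable.fun_const_smul (AEMeasurable.sub ?_ aemeasurable_const) _
    refine (WithLp.measurable_toLp 2 _).comp_aemeasurable (aemeasurable_pi_iff.2 fun a => ?_)
    rcases a with (a | j) | ij | j
    · exact hmuHat n
    · simp only [Sum.elim_inl, Sum.elim_inr]
      have := hbetaHat n
      fun_prop
    · simp only [Sum.elim_inl, Sum.elim_inr, vech, sampleCov_apply, sampleMean_apply]
      fun_prop
    · simp only [Sum.elim_inr, sampleMean_apply]
      fun_prop
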